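/- **Theorem A.6.** Let $\mathcal B$ be a $C^*$-algebra of bounded operators acting irreducibly on a complex Hilbert space $\mathcal H$, let $G$ be a compact (Hausdorff) group and $U$ a strongly continuous unitary representation of $G$ on $\mathcal H$ inducing an action $\alpha$ of $G$ on $\mathcal B$; that is, $\alpha_g(B)=U(g)BU(g)^*\in\mathcal B$ for all $g\in G$, $B\in\mathcal B$, and $g\mapsto\alpha_g(B)$ is norm continuous for each $B\in\mathcal B$. A *Hilbert space in* $\mathcal B$ is a norm-closed linear subspace $E\subset\mathcal B$ such that $\psi^*\varphi\in\mathbb C I$ for all $\psi,\varphi\in E$, with inner product given by $\langle\psi,\varphi\rangle I=\psi^*\varphi$. Suppose that $\alpha$ has *full Hilbert spectrum*: every irreducible continuous unitary representation of $G$ is unitarily equivalent to the restriction of $\alpha$ to some $\alpha$-invariant Hilbert space in $\mathcal B$. Let $\mathcal B^G=\{B\in\mathcal B:\alpha_g(B)=B\ \text{for all } g\in G\}$ be the fixed-point algebra. Call a representation $\pi$ (a $*$-homomorphism of $\mathcal B$ into the bounded operators on a Hilbert space $\mathcal H_\pi$) *normal* on a $C^*$-subalgebra $\mathcal A\subset\mathcal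 B$ if $\pi|_{\mathcal A}$ is continuous for the ultraweak ($\sigma$-weak) topologies of $B(\mathcal H)$ and $B(\mathcal H_\pi)$. Then every representation $\pi$ of $\mathcal B$ that is normal on $\mathcal B^G$ is normal on $\mathcal B$. -/

import Mathlib

noncomputable section

section OperatorAlgebras

variable {H : Type*} [NormedAddCommGroup H] [InnerProductSpace ℂ H] [CompleteSpace H]

/-- A set of bounded operators acts irreducibly on the (nonzero) Hilbert space `H`: its only closed
invariant subspaces are `0` and `H`. -/
def ActsIrreducibly (S : Set (H →L[ℂ] H)) : Prop :=
  Nontrivial H ∧ ∀ M : Submodule ℂ H, IsClosed (M : Set H) →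
    (∀ T ∈ S, ∀ x ∈ M, T x ∈ M) → M = ⊥ ∨ M = ⊤

variable (H) in
/-- The ultraweak (σ-weak) topology on `B(H)`: the coarsest topology for which all functionals
`T ↦ ∑ₙ ⟪xₙ, T yₙ⟫`, with square-summable sequences of vectors `x` and `y`, are continuous. -/
abbrev ultraweakTopology : TopologicalSpace (H →L[ℂ] H) :=
  ⨅ (x : lp (fun _ : ℕ => H) 2) (y : lp (fun _ : ℕ => H) 2),
    TopologicalSpace.induced (fun T : H →L[ℂ] H => ∑' n, inner ℂ (x n) (T (y n))) inferInstance

/-- The representation `π` of the operator algebra `B` is normal on the subalgebra `A`: its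
restriction to the elements of `A` is continuous for the ultraweak topologies of `B(H)` and `B(K)`.
It is applied to `A ≤ B`. -/
def IsNormalOn {K : Type*} [NormedAddCommGroup K] [InnerProductSpace ℂ K] [CompleteSpace K]
    {B : NonUnitalStarSubalgebra ℂ (H →L[ℂ] H)} (π : B →⋆ₙₐ[ℂ] (K →L[ℂ] K))
    (A : NonUnitalStarSubalgebra ℂ (H →L[ℂ] H)) : Prop :=
  @Continuous {b : B // (b : H →L[ℂ] H) ∈ A} (K →L[ℂ] K)
    (TopologicalSpace.induced (fun b => ((b : B) : H →L[ℂ] H)) (ultraweakTopology H))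
    (ultraweakTopology K) (fun b => π b)

/-- A Hilbert space in `B`: a norm-closed linear subspace `E` of `B` such that `ψ* φ` is a scalar
for all `ψ, φ ∈ E` (this scalar is the inner product of `E`). -/
structure IsHilbertSpaceIn (B : NonUnitalStarSubalgebra ℂ (H →L[ℂ] H))
    (E : Submodule ℂ (H →L[ℂ] H)) : Prop where
  mem : ∀ ψ ∈ E, ψ ∈ B
  isClosed : IsClosed (E : Set (H →L[ℂ] H))
  scalar : ∀ ψ ∈ E, ∀ φ ∈ E, ∃ c : ℂ, star ψ * φ = c • (1 : H →L[ℂ] H)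

end OperatorAlgebras

section CompactGroupActions

variable {G : Type*} [Group G] [TopologicalSpace G]
  {H : Type*} [NormedAddCommGroup H] [InnerProductSpace ℂ H] [CompleteSpace H]

/-- Strong continuity of a unitary representation. -/
def IsContinuousUnitaryRep (U : G →* unitary (H →L[ℂ] H)) : Prop :=
  ∀ x : H, Continuous fun g => (U g : H →L[ℂ] H) x

/-- The automorphism `T ↦ U(g) T U(g)*` of `B(H)`. -/
def conjBy (U : G →* unitary (H →L[ℂ] H)) (g : G) (T : H →L[ℂ] H) : H →L[ℂ] H :=
  (U g : H →L[ℂ] H) * T * star (U g : H →L[ℂ] H)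

/-- `U` induces an action of the topological group `G` on the C⋆-algebra `B`: each `Ad U(g)` maps
`B` into itself (hence onto itself), and the orbit maps `g ↦ U(g) b U(g)*`, `b ∈ B`, are
continuous in norm. -/
structure InducesAction (U : G →* unitary (H →L[ℂ] H))
    (B : NonUnitalStarSubalgebra ℂ (H →L[ℂ] H)) : Prop where
  mem : ∀ g, ∀ b ∈ B, conjBy U g b ∈ B
  continuous : ∀ b ∈ B, Continuous fun g => conjBy U g b

/-- The fixed-point algebra `B^G`. -/
def fixedPointAlgebra (U : G →* unitary (H →L[ℂ] H))
    (B : NonUnitalStarSubalgebra ℂ (H →L[ℂ] H)) : NonUnitalStarSubalgebra ℂ (H →L[ℂ] H) where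
  carrier := {b | b ∈ B ∧ ∀ g, conjBy U g b = b}
  add_mem' := by
    rintro a b ⟨ha, ha'⟩ ⟨hb, hb'⟩
    refine ⟨add_mem ha hb, fun g => ?_⟩
    have h1 := ha' g
    have h2 := hb' g
    simp only [conjBy] at h1 h2 ⊢
    rw [mul_add, add_mul, h1, h2]
  zero_mem' := ⟨zero_mem B, fun g => by simp [conjBy]⟩
  mul_mem' := by
    rintro a b ⟨ha, ha'⟩ ⟨hb, hb'⟩
    refine ⟨mul_mem ha hb, fun g => ?_⟩
    have h1 := ha' g
    have h2 := hb' g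
    have hu : star (U g : H →L[ℂ] H) * (U g : H →L[ℂ] H) = 1 := Unitary.coe_star_mul_self (U g)
    simp only [conjBy] at h1 h2 ⊢
    calc (U g : H →L[ℂ] H) * (a * b) * star (U g : H →L[ℂ] H)
        = (U g : H →L[ℂ] H) * a * (star (U g : H →L[ℂ] H) * (U g : H →L[ℂ] H)) * b *
            star (U g : H →L[ℂ] H) := by rw [hu, mul_one, mul_assoc (U g : H →L[ℂ] H) a b]
      _ = ((U g : H →L[ℂ] H) * a * star (U g : H →L[ℂ] H)) *
            ((U g : H →L[ℂ] H) * b * star (U g : H →L[ℂ] H)) := by simp only [mul_assoc]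
      _ = a * b := by rw [h1, h2]
  smul_mem' := by
    rintro c a ⟨ha, ha'⟩
    refine ⟨SMulMemClass.smul_mem c ha, fun g => ?_⟩
    have h1 := ha' g
    simp only [conjBy] at h1 ⊢
    rw [mul_smul_comm, smul_mul_assoc, h1]
  star_mem' := by
    rintro a ⟨ha, ha'⟩
    refine ⟨star_mem ha, fun g => ?_⟩
    have h1 := congrArg star (ha' g)
    simp only [conjBy, star_mul, star_star] at h1 ⊢
    rw [mul_assoc, h1]

/-- The action induced by `U` on `B` has full Hilbert spectrum: every irreducible continuous unitary
representation `σ` of `G` is realized on some Hilbert space `E` in `B`, i.e. there is a unitary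
equivalence `T` from `σ` onto the restriction of the action to `E`. As `G` is compact, it is enough
to take `σ` on the finite-dimensional Hilbert spaces `ℂⁿ`. -/
def HasFullHilbertSpectrum (U : G →* unitary (H →L[ℂ] H))
    (B : NonUnitalStarSubalgebra ℂ (H →L[ℂ] H)) : Prop :=
  ∀ (n : ℕ) (σ : G →* unitary (EuclideanSpace ℂ (Fin n) →L[ℂ] EuclideanSpace ℂ (Fin n))),
    IsContinuousUnitaryRep σ →
    ActsIrreducibly (Set.range fun g =>
      (σ g : EuclideanSpace ℂ (Fin n) →L[ℂ] EuclideanSpace ℂ (Fin n))) →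
    ∃ E : Submodule ℂ (H →L[ℂ] H), IsHilbertSpaceIn B E ∧
      ∃ T : EuclideanSpace ℂ (Fin n) ≃ₗ[ℂ] E,
        (∀ v w, star (T v : H →L[ℂ] H) * (T w : H →L[ℂ] H) =
          (inner ℂ v w : ℂ) • (1 : H →L[ℂ] H)) ∧
        ∀ g v, conjBy U g (T v : H →L[ℂ] H) =
          T ((σ g : EuclideanSpace ℂ (Fin n) →L[ℂ] EuclideanSpace ℂ (Fin n)) v)

end CompactGroupActions

end

/-! The ultraweak functionals of `π` are matrix coefficients of its countable multiple, so it is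
enough that the essential part of this multiple (again written `π` below) is a multiple of the
identical representation of `B`: its coefficients then have the form `∑ ⟪ξₙ, b ηₙ⟫`. Equivalently,
an operator `Q` commuting with `π(B)` and annihilating the range of every `B`-intertwiner `W : H →
K` annihilates every `z` with `π(1) z = z`.

Normality supplies this for the fixed-point algebra. The functional `a ↦ ⟪z, π(a) z⟫` on `B^G` is a
finite combination of functionals `∑ ⟪xₙ, a yₙ⟫`; evaluated at `a* a`, this dominates `z` by vectors
of a multiple of the identical representation, so `z` is a value of a `B^G`-intertwiner from that
multiple. It remains to show that `Q` annihilates every `B^G`-intertwiner `S : H → K`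
(`comp_eq_zero_of_intertwinesOn`).

The bridge from `B^G` to `B` is the multiplets `ψ` in `B`. Each spectral component of an element of
`B` is `A ψ` with `A ∈ B^G`, and by Peter–Weyl a continuous function on `G` without nontrivial
components is constant. The central fact (`IsMultiplet.inner_map_eq_zero`) is `⟪S y, π(ψ) S x⟫ = 0`
for `G`-fixed vectors `x`, `y` and `ψ` of nontrivial type. Indeed `R = S* π(ψ) S` satisfies `R A =
ρ(A) R` on `B^G`, where `ρ(A) = ∑ ψᵢ A ψᵢ*`; averaging over `G` turns this into an identity between
finite-rank functionals on `B`, which by irreducibility persists for all bounded operators, and a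
rank-one operator gives the claim.

Hence `g ↦ ⟪S x, π(α_g(b* b)) S x⟫` is constant, and comparison with its mean gives `‖π(b) S x‖² ≤
‖S* S‖ ‖b x‖²`. So `S x` is a value of a `B`-intertwiner and `Q S x = 0` for fixed `x`. Multiplets
carry this over to `Q S c x = 0` for all `c ∈ B`, and irreducibility, together with the existence of
a nonzero fixed vector, yields `Q S = 0`. -/

noncomputable section

open scoped InnerProductSpace
open MeasureTheory

universe u

/-! ### Reducing subspaces and Schur's lemma -/

section HilbertSpaceOperators

variable {H : Type*} [NormedAddCommGroup H] [InnerProductSpace ℂ H] [CompleteSpace H]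

/-- The orthogonal projection onto a closed subspace invariant under `T` and `T*` commutes with
`T`. -/
theorem starProjection_comm_of_invariant {N : Submodule ℂ H} [N.HasOrthogonalProjection]
    {T : H →L[ℂ] H} (h1 : ∀ x ∈ N, T x ∈ N) (h2 : ∀ x ∈ N, star T x ∈ N) (x : H) :
    N.starProjection (T x) = T (N.starProjection x) := by
  refine (Submodule.eq_starProjection_of_mem_of_inner_eq_zero
    (h1 _ (Submodule.starProjection_apply_mem N x)) fun w hw => ?_)
  rw [← map_sub, ← ContinuousLinearMap.adjoint_inner_right]
  exact Submodule.inner_left_of_mem_orthogonal (h2 w hw)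
    (Submodule.sub_starProjection_mem_orthogonal x)

/-- For real `r` the kernel of the positive part of `T - r` is a closed invariant subspace, so `T -
r` is either nonnegative or nonpositive. Two vectors with different Rayleigh quotients would
contradict this at the midpoint of the quotients; hence the quadratic form of `T` is a multiple of
the norm squared. -/
theorem exists_eq_smul_one_of_isSelfAdjoint_of_commute
    {B : NonUnitalStarSubalgebra ℂ (H →L[ℂ] H)}
    (hB : ActsIrreducibly (B : Set (H →L[ℂ] H))) {T : H →L[ℂ] H} (hT : IsSelfAdjoint T)
    (hc : ∀ b ∈ B, Commute b T) : ∃ c : ℂ, T = c • (1 : H →L[ℂ] H) := by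
  have key : ∀ r : ℝ, 0 ≤ T - (r : ℂ) • (1 : H →L[ℂ] H) ∨ T - (r : ℂ) • (1 : H →L[ℂ] H) ≤ 0 := by
    intro r
    set S := T - (r : ℂ) • (1 : H →L[ℂ] H) with hS
    have hSa : IsSelfAdjoint S := by
      refine hT.sub ?_
      rw [isSelfAdjoint_iff]
      simp
    have hSc : ∀ b ∈ B, Commute b (S⁺) := by
      intro b hb
      have h : Commute S b := ((hc b hb).sub_right ((Commute.one_right b).smul_right _)).symm
      rw [CFC.posPart_def]
      exact (h.cfcₙ_real _).symm
    rcases hB.2 (LinearMap.ker (S⁺ : H →L[ℂ] H).toLinearMap) (S⁺ : H →L[ℂ] H).isClosed_ker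
      (fun b hb x hx => by
        have := DFunLike.congr_fun (hSc b hb).eq x
        simp only [mul_apply_eq_comp] at this
        have hx' : (S⁺ : H →L[ℂ] H) x = 0 := hx
        change (S⁺ : H →L[ℂ] H) (b x) = 0
        rw [← this, hx', map_zero]) with h | h
    · left
      have hm : (S⁻ : H →L[ℂ] H) = 0 := by
        ext x
        have : (S⁻ : H →L[ℂ] H) x ∈ LinearMap.ker (S⁺ : H →L[ℂ] H).toLinearMap := by
          change (S⁺ * S⁻ : H →L[ℂ] H) x = 0
          rw [CFC.posPart_mul_negPart]; rfl
        rw [h] at this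
        simpa using this
      rw [← CFC.posPart_sub_negPart S hSa, hm, sub_zero]
      exact CFC.posPart_nonneg S
    · right
      have hp : (S⁺ : H →L[ℂ] H) = 0 := by
        ext x
        have : x ∈ LinearMap.ker (S⁺ : H →L[ℂ] H).toLinearMap := by rw [h]; trivial
        exact this
      rw [← CFC.posPart_sub_negPart S hSa, hp, zero_sub]
      exact neg_nonpos.2 (CFC.negPart_nonneg S)
  have := hB.1
  obtain ⟨e, he⟩ := exists_ne (0 : H)
  set q : H → ℝ := fun x => (⟪T x, x⟫_ℂ).re with hq
  set r : ℝ := q e / ‖e‖ ^ 2 with hr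
  have he2 : 0 < ‖e‖ ^ 2 := by positivity
  have hre : ∀ (s : ℝ) (x : H), (⟪(T - (s : ℂ) • (1 : H →L[ℂ] H)) x, x⟫_ℂ).re = q x - s * ‖x‖ ^ 2 := by
    intro s x
    have : ⟪x, x⟫_ℂ = ((‖x‖ ^ 2 : ℝ) : ℂ) := by
      rw [inner_self_eq_norm_sq_to_K]; push_cast; rfl
    simp only [sub_apply, smul_apply,
      one_apply_eq_self, inner_sub_left, inner_smul_left, Complex.sub_re, this, hq,
      Complex.conj_ofReal, ← Complex.ofReal_mul, Complex.ofReal_re]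
  have hpos : ∀ (A : H →L[ℂ] H), 0 ≤ A → ∀ x, 0 ≤ (⟪A x, x⟫_ℂ).re := fun A hA x =>
    ((ContinuousLinearMap.nonneg_iff_isPositive A).1 hA).re_inner_nonneg_left x
  have hqx : ∀ x, q x = r * ‖x‖ ^ 2 := by
    have hs : ∀ s : ℝ, (∀ x, s * ‖x‖ ^ 2 ≤ q x) ∨ (∀ x, q x ≤ s * ‖x‖ ^ 2) := by
      intro s
      rcases key s with h | h
      · left; intro x
        have := hpos _ h x
        rw [hre] at this; linarith
      · right; intro x
        have := hpos _ (neg_nonneg.2 h) x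
        rw [neg_apply, inner_neg_left, Complex.neg_re, hre] at this; linarith
    have hqe : q e = r * ‖e‖ ^ 2 := by rw [hr]; field_simp
    intro x
    rcases eq_or_ne x 0 with rfl | hx
    · simp [hq]
    have hx2 : 0 < ‖x‖ ^ 2 := by positivity
    have hqx : q x = (q x / ‖x‖ ^ 2) * ‖x‖ ^ 2 := by field_simp
    set t := q x / ‖x‖ ^ 2 with ht
    rcases lt_trichotomy t r with h | h | h
    · exfalso
      rcases hs ((t + r) / 2) with h' | h'
      · have := h' x; rw [hqx] at this; nlinarith
      · have := h' e; rw [hqe] at this; nlinarith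
    · rw [hqx, h]
    · exfalso
      rcases hs ((t + r) / 2) with h' | h'
      · have := h' e; rw [hqe] at this; nlinarith
      · have := h' x; rw [hqx] at this; nlinarith
  refine ⟨r, ?_⟩
  have hS : IsSelfAdjoint (T - (r : ℂ) • (1 : H →L[ℂ] H)) := by
    refine hT.sub ?_
    rw [isSelfAdjoint_iff]
    simp
  refine sub_eq_zero.1 (ContinuousLinearMap.coe_injective
    ((ContinuousLinearMap.isSelfAdjoint_iff_isSymmetric.1 hS).inner_map_self_eq_zero.1 fun x => ?_))
  have h1 := hre r x
  rw [hqx, sub_self] at h1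
  have h2 := (ContinuousLinearMap.isSelfAdjoint_iff_isSymmetric.1 hS).coe_re_inner_apply_self x
  rw [← h2]
  exact (congrArg Complex.ofReal h1).trans Complex.ofReal_zero

/-- **Schur's lemma** for an irreducible algebra of bounded operators. -/
theorem exists_eq_smul_one_of_commute {B : NonUnitalStarSubalgebra ℂ (H →L[ℂ] H)}
    (hB : ActsIrreducibly (B : Set (H →L[ℂ] H))) {T : H →L[ℂ] H}
    (hc : ∀ b ∈ B, Commute b T) : ∃ c : ℂ, T = c • (1 : H →L[ℂ] H) := by
  have hc' : ∀ b ∈ B, Commute b (star T) := fun b hb => by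
    simpa using (hc (star b) (star_mem hb)).star_star
  obtain ⟨c, h1⟩ := exists_eq_smul_one_of_isSelfAdjoint_of_commute hB (IsSelfAdjoint.add_star_self T)
    fun b hb => (hc b hb).add_right (hc' b hb)
  obtain ⟨d, h2⟩ := exists_eq_smul_one_of_isSelfAdjoint_of_commute hB (T := Complex.I • (T - star T))
    (by rw [isSelfAdjoint_iff]; simp [sub_eq_add_neg, add_comm])
    fun b hb => ((hc b hb).sub_right (hc' b hb)).smul_right _
  refine ⟨(c - Complex.I * d) / 2, ?_⟩
  have h3 : T - star T = (-Complex.I * d) • (1 : H →L[ℂ] H) := by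
    rw [mul_smul, ← h2, smul_smul]; simp
  have h4 : (2 : ℂ) • T = (c - Complex.I * d) • (1 : H →L[ℂ] H) := by
    rw [sub_eq_add_neg, add_smul, ← neg_mul, ← h3, ← h1, two_smul]; abel
  rw [div_eq_inv_mul, mul_smul, ← h4, smul_smul]; simp

end HilbertSpaceOperators

/-! ### Multiples of the identical representation -/

section Amplification

variable {H : Type*} [NormedAddCommGroup H] [InnerProductSpace ℂ H]

/-- The diagonal operator `⨁ T` on the Hilbert sum of copies of `H` indexed by `ι`. -/
def ampCLM (ι : Type*) (T : H →L[ℂ] H) :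
    lp (fun _ : ι => H) 2 →L[ℂ] lp (fun _ : ι => H) 2 :=
  have hmem : ∀ x : lp (fun _ : ι => H) 2, Memℓp (fun i => T (x i)) 2 := fun x =>
    ((lp.memℓp x).norm.const_mul ‖T‖).mono' fun i =>
      (T.le_opNorm _).trans (le_abs_self _)
  LinearMap.mkContinuous
    { toFun := fun x => ⟨fun i => T (x i), hmem x⟩
      map_add' := fun x y => by ext i; exact map_add T (x i) (y i)
      map_smul' := fun c x => by ext i; exact map_smul T c (x i) } ‖T‖ fun x => by
    have h2 : (0 : ℝ) < (2 : ENNReal).toReal := by norm_num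
    refine lp.norm_le_of_forall_sum_le h2 (by positivity) fun s => ?_
    calc ∑ i ∈ s, ‖T (x i)‖ ^ (2 : ENNReal).toReal
        ≤ ∑ i ∈ s, ‖T‖ ^ (2 : ENNReal).toReal * ‖x i‖ ^ (2 : ENNReal).toReal := by
          refine Finset.sum_le_sum fun i _ => ?_
          rw [← Real.mul_rpow (norm_nonneg _) (norm_nonneg _)]
          exact Real.rpow_le_rpow (norm_nonneg _) (T.le_opNorm _) h2.le
      _ ≤ (‖T‖ * ‖x‖) ^ (2 : ENNReal).toReal := by
          rw [← Finset.mul_sum, Real.mul_rpow (norm_nonneg _) (norm_nonneg _)]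
          gcongr
          exact lp.sum_rpow_le_norm_rpow h2 x s

@[simp]
theorem ampCLM_apply (ι : Type*) (T : H →L[ℂ] H) (x : lp (fun _ : ι => H) 2) (i : ι) :
    ampCLM ι T x i = T (x i) := rfl

theorem eq_of_comp_single {ι : Type*} {K : Type*} [NormedAddCommGroup K] [NormedSpace ℂ K]
    [DecidableEq ι] {V W : lp (fun _ : ι => H) 2 →L[ℂ] K}
    (h : ∀ i x, V (lp.single 2 i x) = W (lp.single 2 i x)) : V = W :=
  lp.ext_continuousLinearMap (by norm_num) fun i => by ext x; exact h i x

variable (H) [CompleteSpace H] in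
/-- The amplification `T ↦ ⨁ T` as a homomorphism of star-algebras. -/
def amp (ι : Type*) :
    (H →L[ℂ] H) →⋆ₙₐ[ℂ] (lp (fun _ : ι => H) 2 →L[ℂ] lp (fun _ : ι => H) 2) where
  toFun := ampCLM ι
  map_smul' c T := by ext x i; simp
  map_zero' := by ext x i; simp
  map_add' S T := by ext x i; simp
  map_mul' S T := by ext x i; simp
  map_star' T := by
    refine (ContinuousLinearMap.eq_adjoint_iff _ _).2 fun x y => ?_
    simp only [lp.inner_eq_tsum, ampCLM_apply, ContinuousLinearMap.star_eq_adjoint,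
      ContinuousLinearMap.adjoint_inner_left]

variable [CompleteSpace H]

@[simp]
theorem amp_apply (ι : Type*) (T : H →L[ℂ] H) (x : lp (fun _ : ι => H) 2) (i : ι) :
    amp H ι T x i = T (x i) := rfl

theorem amp_single {ι : Type*} [DecidableEq ι] (T : H →L[ℂ] H) (i : ι) (h : H) :
    amp H ι T (lp.single 2 i h) = lp.single 2 i (T h) := by
  ext j
  by_cases hj : j = i
  · subst hj; simp
  · simp [hj]

end Amplification

/-! ### Density of an irreducible algebra in finitely many vectors -/

section Density

variable {H : Type*} [NormedAddCommGroup H] [InnerProductSpace ℂ H] [CompleteSpace H]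

/-- A finite-rank functional vanishing on an irreducible algebra of operators containing `1`
vanishes on all bounded operators. -/
theorem sum_inner_eq_zero_of_irreducible {B : NonUnitalStarSubalgebra ℂ (H →L[ℂ] H)}
    (hB : ActsIrreducibly (B : Set (H →L[ℂ] H))) (h1 : (1 : H →L[ℂ] H) ∈ B) {ι : Type*} [Fintype ι]
    (u z : ι → H) (h : ∀ b ∈ B, ∑ i, ⟪u i, b (z i)⟫_ℂ = 0) (T : H →L[ℂ] H) :
    ∑ i, ⟪u i, T (z i)⟫_ℂ = 0 := by
  classical
  set ζ : lp (fun _ : ι => H) 2 := ⟨z, Memℓp.all z⟩ with hζ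
  set υ : lp (fun _ : ι => H) 2 := ⟨u, Memℓp.all u⟩ with hυ
  have hin : ∀ S : H →L[ℂ] H, ⟪υ, amp H ι S ζ⟫_ℂ = ∑ i, ⟪u i, S (z i)⟫_ℂ := fun S => by
    rw [lp.inner_eq_tsum, tsum_fintype]; rfl
  set N₀ : Submodule ℂ (lp (fun _ : ι => H) 2) :=
    { carrier := {ξ | ∃ b ∈ B, amp H ι b ζ = ξ}
      add_mem' := by
        rintro _ _ ⟨a, ha, rfl⟩ ⟨b, hb, rfl⟩
        exact ⟨a + b, add_mem ha hb, by rw [map_add]; rfl⟩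
      zero_mem' := ⟨0, zero_mem B, by rw [map_zero]; rfl⟩
      smul_mem' := by
        rintro c _ ⟨a, ha, rfl⟩
        exact ⟨c • a, SMulMemClass.smul_mem c ha, by rw [map_smul]; rfl⟩ } with hN₀
  set N := N₀.topologicalClosure with hN
  have : CompleteSpace N := N₀.isClosed_topologicalClosure.completeSpace_coe
  have hinv : ∀ b ∈ B, ∀ ξ ∈ N, amp H ι b ξ ∈ N := by
    intro b hb ξ hξ
    refine map_mem_closure (amp H ι b).continuous hξ ?_
    rintro _ ⟨a, ha, rfl⟩
    exact ⟨b * a, mul_mem hb ha, by rw [map_mul]; rfl⟩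
  set P := N.starProjection with hP
  have hPc : ∀ b ∈ B, ∀ ξ, P (amp H ι b ξ) = amp H ι b (P ξ) := fun b hb =>
    starProjection_comm_of_invariant (hinv b hb) fun ξ hξ => by
      rw [← map_star]; exact hinv _ (star_mem hb) ξ hξ
  -- The matrix entries of `P` commute with `B`, so they are scalars by Schur's lemma. A matrix of
  -- scalars commutes with every diagonal operator `⨁ T`, whether or not `T` lies in `B`.
  have hentry : ∀ i j, ∃ c : ℂ, ∀ x, P (lp.single 2 j x) i = c • x := by
    intro i j
    obtain ⟨c, hc⟩ := exists_eq_smul_one_of_commute hB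
      (T := (lp.evalCLM ℂ (fun _ : ι => H) 2 i) ∘L P ∘L
        (lp.singleContinuousLinearMap ℂ (fun _ : ι => H) 2 j)) fun b hb => by
        ext x
        change b (P (lp.single 2 j x) i) = P (lp.single 2 j (b x)) i
        rw [← amp_single, hPc b hb, amp_apply]
    exact ⟨c, fun x => DFunLike.congr_fun hc x⟩
  have hPT : P ∘L amp H ι T = amp H ι T ∘L P := by
    refine eq_of_comp_single fun j x => ?_
    ext i
    obtain ⟨c, hc⟩ := hentry i j
    change P (amp H ι T (lp.single 2 j x)) i = T (P (lp.single 2 j x) i)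
    rw [amp_single, hc, hc, map_smul]
  have hmem : ζ ∈ N := N₀.le_topologicalClosure ⟨1, h1, by ext; rfl⟩
  have hTζ : amp H ι T ζ ∈ N := by
    have := DFunLike.congr_fun hPT ζ
    change P (amp H ι T ζ) = amp H ι T (P ζ) at this
    rw [hP, Submodule.starProjection_eq_self_iff.2 hmem] at this
    rw [← this]
    exact Submodule.starProjection_apply_mem N _
  rw [← hin]
  have hle : N ≤ (ℂ ∙ υ)ᗮ := by
    refine N₀.topologicalClosure_minimal ?_ (Submodule.isClosed_orthogonal _)
    rintro _ ⟨b, hb, rfl⟩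
    rw [Submodule.mem_orthogonal_singleton_iff_inner_right, hin, h b hb]
  exact Submodule.mem_orthogonal_singleton_iff_inner_right.1 (hle hTζ)

end Density

/-! ### Intertwiners from domination of vectors -/

section Domination

variable {A D K : Type*} [NonUnitalRing A] [StarRing A] [Module ℂ A]
  [NormedAddCommGroup D] [InnerProductSpace ℂ D] [CompleteSpace D]
  [NormedAddCommGroup K] [InnerProductSpace ℂ K] [CompleteSpace K]

/-- If the vector `y` of a representation is dominated by the vector `ζ` of another one, then it is
the image of `ζ` under a bounded intertwining operator. -/
theorem exists_intertwiner_of_norm_le (θ : A →⋆ₙₐ[ℂ] (D →L[ℂ] D)) (π : A →⋆ₙₐ[ℂ] (K →L[ℂ] K))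
    (ζ : D) (y : K) (C : ℝ) (h : ∀ a, ‖π a y‖ ≤ C * ‖θ a ζ‖)
    (h1 : ∃ e, θ e ζ = ζ ∧ π e y = y) :
    ∃ V : D →L[ℂ] K, (∀ a ξ, V (θ a ξ) = π a (V ξ)) ∧ V ζ = y := by
  set e₀ : A →ₗ[ℂ] D :=
    { toFun := fun a => θ a ζ
      map_add' := fun a b => by rw [map_add]; rfl
      map_smul' := fun c a => by rw [map_smul]; rfl } with he₀
  set f : A →ₗ[ℂ] K :=
    { toFun := fun a => π a y
      map_add' := fun a b => by rw [map_add]; rfl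
      map_smul' := fun c a => by rw [map_smul]; rfl } with hf
  set N := (LinearMap.range e₀).topologicalClosure with hN
  have : CompleteSpace N := (LinearMap.range e₀).isClosed_topologicalClosure.completeSpace_coe
  set e₁ : A →ₗ[ℂ] N := e₀.codRestrict N fun a =>
    (LinearMap.range e₀).le_topologicalClosure ⟨a, rfl⟩ with he₁
  have hdense : DenseRange e₁ := by
    intro x
    rw [closure_subtype]
    have hrange : Subtype.val '' Set.range e₁ = (LinearMap.range e₀ : Set D) := by
      ext y
      constructor
      · rintro ⟨_, ⟨a, rfl⟩, rfl⟩; exact ⟨a, rfl⟩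
      · rintro ⟨a, rfl⟩; exact ⟨e₁ a, ⟨a, rfl⟩, rfl⟩
    rw [hrange]
    exact x.2
  -- Domination makes `θ a ζ ↦ π a y` well defined and bounded; it extends to the closed cyclic
  -- subspace `N`. As `N` is reducing, extension by zero on its complement keeps the intertwining
  -- property.
  set V₀ : N →L[ℂ] K := f.extendOfNorm e₁ with hV₀
  have hV₀e : ∀ a, V₀ (e₁ a) = π a y := fun a =>
    LinearMap.extendOfNorm_eq hdense ⟨C, h⟩ a
  have hinv : ∀ a, ∀ ξ ∈ N, θ a ξ ∈ N := by
    intro a ξ hξ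
    refine map_mem_closure (θ a).continuous hξ ?_
    rintro _ ⟨b, rfl⟩
    exact ⟨a * b, by simp only [he₀, LinearMap.coe_mk, AddHom.coe_mk, map_mul]; rfl⟩
  have hcomm : ∀ a (ξ : N), V₀ ⟨θ a ξ, hinv a ξ ξ.2⟩ = π a (V₀ ξ) := by
    intro a ξ
    refine hdense.induction_on (p := fun ξ : N => V₀ ⟨θ a ξ, hinv a ξ ξ.2⟩ = π a (V₀ ξ)) ξ
      (isClosed_eq (by fun_prop) (by fun_prop)) fun b => ?_
    rw [hV₀e, ← mul_apply_eq_comp, ← map_mul, ← hV₀e]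
    congr 1
    ext
    simp only [he₁, he₀, LinearMap.codRestrict_apply, LinearMap.coe_mk, AddHom.coe_mk, map_mul]
    rfl
  refine ⟨V₀ ∘L N.orthogonalProjectionOnto, fun a ξ => ?_, ?_⟩
  · have := starProjection_comm_of_invariant (N := N) (hinv a)
      (fun x hx => by rw [← map_star]; exact hinv _ x hx) ξ
    rw [ContinuousLinearMap.comp_apply, ContinuousLinearMap.comp_apply, ← hcomm]
    congr 1
    ext
    exact this
  -- The representations may be degenerate; the element `e` acting as a unit on both vectors places
  -- `ζ` in `N` and identifies its image.
  · obtain ⟨e, he, he'⟩ := h1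
    have hmem : ζ ∈ N := (LinearMap.range e₀).le_topologicalClosure ⟨e, he⟩
    have h2 : N.orthogonalProjectionOnto ζ = e₁ e := by
      ext
      rw [he₁, LinearMap.codRestrict_apply]
      exact (Submodule.starProjection_eq_self_iff.2 hmem).trans he.symm
    rw [ContinuousLinearMap.comp_apply, h2, hV₀e, he']

end Domination

/-! ### Unitary representations and irreducible subspaces -/

section UnitaryReps

variable {G : Type*} [Group G]
  {H : Type*} [NormedAddCommGroup H] [InnerProductSpace ℂ H] [CompleteSpace H]

/-- A star-preserving representation by bounded operators is unitary. -/
def unitaryRepOfStar (s : G → (H →L[ℂ] H)) (h1 : s 1 = 1) (hmul : ∀ g h, s (g * h) = s g * s h)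
    (hstar : ∀ g, star (s g) = s g⁻¹) : G →* unitary (H →L[ℂ] H) where
  toFun g := ⟨s g, by
    rw [Unitary.mem_iff, hstar, ← hmul, ← hmul, inv_mul_cancel, mul_inv_cancel, h1]
    exact ⟨rfl, rfl⟩⟩
  map_one' := Subtype.ext h1
  map_mul' g h := Subtype.ext (hmul g h)

theorem star_unitaryRep (U : G →* unitary (H →L[ℂ] H)) (g : G) :
    star (U g : H →L[ℂ] H) = (U g⁻¹ : H →L[ℂ] H) := by
  rw [map_inv, ← Unitary.star_eq_inv, Unitary.coe_star]

theorem inner_unitaryRep_left (U : G →* unitary (H →L[ℂ] H)) (g : G) (x y : H) :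
    ⟪(U g : H →L[ℂ] H) x, y⟫_ℂ = ⟪x, (U g⁻¹ : H →L[ℂ] H) y⟫_ℂ := by
  rw [← star_unitaryRep, ContinuousLinearMap.star_eq_adjoint,
    ContinuousLinearMap.adjoint_inner_right]

theorem inner_unitaryRep_right (U : G →* unitary (H →L[ℂ] H)) (g : G) (x y : H) :
    ⟪x, (U g : H →L[ℂ] H) y⟫_ℂ = ⟪(U g⁻¹ : H →L[ℂ] H) x, y⟫_ℂ := by
  rw [← star_unitaryRep, ContinuousLinearMap.star_eq_adjoint,
    ContinuousLinearMap.adjoint_inner_left]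

theorem unitaryRep_mul_apply (U : G →* unitary (H →L[ℂ] H)) (g h : G) (x : H) :
    (U (g * h) : H →L[ℂ] H) x = (U g : H →L[ℂ] H) ((U h : H →L[ℂ] H) x) := by
  rw [map_mul]; rfl

theorem unitaryRep_one_apply (U : G →* unitary (H →L[ℂ] H)) (x : H) :
    (U 1 : H →L[ℂ] H) x = x := by
  rw [map_one]; rfl

/-- A nonzero finite-dimensional invariant subspace contains an irreducible one. -/
theorem exists_irreducible_intertwiner [TopologicalSpace G] (U : G →* unitary (H →L[ℂ] H))
    (hU : IsContinuousUnitaryRep U) (E : Submodule ℂ H) [FiniteDimensional ℂ E] (hE : E ≠ ⊥)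
    (hinv : ∀ g, ∀ x ∈ E, (U g : H →L[ℂ] H) x ∈ E) :
    ∃ (n : ℕ) (σ : G →* unitary (EuclideanSpace ℂ (Fin n) →L[ℂ] EuclideanSpace ℂ (Fin n)))
      (J : EuclideanSpace ℂ (Fin n) →ₗᵢ[ℂ] H),
      IsContinuousUnitaryRep σ ∧
      ActsIrreducibly (Set.range fun g =>
        (σ g : EuclideanSpace ℂ (Fin n) →L[ℂ] EuclideanSpace ℂ (Fin n))) ∧
      (∀ v, J v ∈ E) ∧
      ∀ g v, (U g : H →L[ℂ] H) (J v) =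
        J ((σ g : EuclideanSpace ℂ (Fin n) →L[ℂ] EuclideanSpace ℂ (Fin n)) v) := by
  obtain ⟨V, ⟨hV0, hVE, hVinv⟩, hVmin⟩ := WellFounded.has_min
    (measure fun V : Submodule ℂ H => Module.finrank ℂ V).wf
    {V | V ≠ ⊥ ∧ V ≤ E ∧ ∀ g, ∀ x ∈ V, (U g : H →L[ℂ] H) x ∈ V} ⟨E, hE, le_rfl, hinv⟩
  have hfin : FiniteDimensional ℂ V := Submodule.finiteDimensional_of_le hVE
  set n := Module.finrank ℂ V with hn
  set J : EuclideanSpace ℂ (Fin n) →ₗᵢ[ℂ] H :=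
    V.subtypeₗᵢ.comp (stdOrthonormalBasis ℂ V).repr.symm.toLinearIsometry with hJ
  have hJV : ∀ v, J v ∈ V := fun v => ((stdOrthonormalBasis ℂ V).repr.symm v).2
  have hJsurj : ∀ x ∈ V, ∃ v, J v = x := fun x hx =>
    ⟨(stdOrthonormalBasis ℂ V).repr ⟨x, hx⟩, by simp [hJ]⟩
  set Jc : EuclideanSpace ℂ (Fin n) →L[ℂ] H := J.toContinuousLinearMap with hJc
  have hJJ : ∀ v w, ⟪J v, J w⟫_ℂ = ⟪v, w⟫_ℂ := fun v w => J.inner_map_map v w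
  set s : G → EuclideanSpace ℂ (Fin n) →L[ℂ] EuclideanSpace ℂ (Fin n) := fun g =>
    (ContinuousLinearMap.adjoint Jc) ∘L (U g : H →L[ℂ] H) ∘L Jc with hs
  have hsJ : ∀ g v, (U g : H →L[ℂ] H) (J v) = J (s g v) := by
    intro g v
    obtain ⟨w, hw⟩ := hJsurj _ (hVinv g _ (hJV v))
    rw [← hw]
    congr 1
    refine ext_inner_left ℂ fun u => ?_
    simp only [hs, ContinuousLinearMap.comp_apply]
    rw [ContinuousLinearMap.adjoint_inner_right]
    change _ = ⟪J u, (U g : H →L[ℂ] H) (J v)⟫_ℂ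
    rw [← hw, hJJ]
  have hs1 : s 1 = 1 := by
    ext1 v
    apply J.injective
    rw [← hsJ, unitaryRep_one_apply]; rfl
  have hsmul : ∀ g h, s (g * h) = s g * s h := by
    intro g h
    ext1 v
    apply J.injective
    rw [← hsJ, unitaryRep_mul_apply, hsJ, hsJ]; rfl
  have hsstar : ∀ g, star (s g) = s g⁻¹ := by
    intro g
    simp only [hs, ContinuousLinearMap.star_eq_adjoint, ContinuousLinearMap.adjoint_comp,
      ContinuousLinearMap.adjoint_adjoint, ← star_unitaryRep U g]
    rfl
  refine ⟨n, unitaryRepOfStar s hs1 hsmul hsstar, J, fun v => ?_, ⟨?_, ?_⟩, fun v => hVE (hJV v),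
    hsJ⟩
  · exact (ContinuousLinearMap.adjoint Jc).continuous.comp (hU (J v))
  · have : Nontrivial V := Submodule.nontrivial_iff_ne_bot.2 hV0
    have : 0 < n := Module.finrank_pos
    exact Module.nontrivial_of_finrank_pos (R := ℂ) (by simpa using this)
  -- By minimality of `V`, the image under `J` of a nonzero invariant `M` cannot have smaller
  -- dimension than `V`.
  · intro M _ hM
    by_cases hM0 : M = ⊥
    · exact Or.inl hM0
    right
    have h1 : Module.finrank ℂ (M.map J.toLinearMap) = Module.finrank ℂ M :=
      (Submodule.equivMapOfInjective J.toLinearMap J.injective M).finrank_eq.symm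
    have h2 := hVmin (M.map J.toLinearMap) ⟨fun h => hM0 ?_, ?_, ?_⟩
    · refine Submodule.eq_top_of_finrank_eq (le_antisymm (Submodule.finrank_le _) ?_)
      rw [finrank_euclideanSpace_fin, ← h1]
      exact not_lt.1 h2
    · exact Submodule.map_injective_of_injective J.injective (h.trans (Submodule.map_bot _).symm)
    · rintro _ ⟨v, _, rfl⟩
      exact hVE (hJV v)
    · rintro g _ ⟨v, hv, rfl⟩
      exact ⟨s g v, hM _ ⟨g, rfl⟩ v hv, (hsJ g v).symm⟩

end UnitaryReps

/-! ### Irreducible subspaces for compact groups -/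

section CompactGroups

variable {G : Type*} [Group G] [TopologicalSpace G] [IsTopologicalGroup G] [CompactSpace G]
  [MeasurableSpace G] [BorelSpace G] {μ : Measure G} [IsProbabilityMeasure μ]
  {H : Type*} [NormedAddCommGroup H] [InnerProductSpace ℂ H] [CompleteSpace H]
  {K : Type*} [NormedAddCommGroup K] [InnerProductSpace ℂ K] [CompleteSpace K]

omit [Group G] [IsTopologicalGroup G] in
theorem integrable_of_continuous {X : Type*} [NormedAddCommGroup X] {f : G → X}
    (hf : Continuous f) : Integrable f μ :=
  hf.integrable_of_hasCompactSupport (HasCompactSupport.of_compactSpace f)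

omit [Group G] [IsTopologicalGroup G] [CompleteSpace H] in
theorem inner_integral_clm_apply {F : G → H →L[ℂ] K} (hF : Continuous F) (x : K) (y : H) :
    ⟪x, (∫ g, F g ∂μ) y⟫_ℂ = ∫ g, ⟪x, F g y⟫_ℂ ∂μ := by
  rw [ContinuousLinearMap.integral_apply (integrable_of_continuous hF), integral_inner]
  exact integrable_of_continuous (hF.clm_apply continuous_const)

/-- The vectors lying in finite-dimensional irreducible subspaces are total in any continuous
unitary representation of a compact group. -/
theorem eq_zero_of_orthogonal_intertwiners [μ.IsHaarMeasure] (U : G →* unitary (H →L[ℂ] H))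
    (hU : IsContinuousUnitaryRep U) (z : H)
    (h : ∀ (n : ℕ) (σ : G →* unitary (EuclideanSpace ℂ (Fin n) →L[ℂ] EuclideanSpace ℂ (Fin n)))
      (J : EuclideanSpace ℂ (Fin n) →ₗᵢ[ℂ] H), IsContinuousUnitaryRep σ →
      ActsIrreducibly (Set.range fun g =>
        (σ g : EuclideanSpace ℂ (Fin n) →L[ℂ] EuclideanSpace ℂ (Fin n))) →
      (∀ g v, (U g : H →L[ℂ] H) (J v) =
        J ((σ g : EuclideanSpace ℂ (Fin n) →L[ℂ] EuclideanSpace ℂ (Fin n)) v)) →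
      ∀ v, ⟪J v, z⟫_ℂ = 0) : z = 0 := by
  by_contra hz
  set F : G → H →L[ℂ] H := fun g =>
    InnerProductSpace.rankOne ℂ ((U g : H →L[ℂ] H) z) ((U g : H →L[ℂ] H) z) with hF
  have hFc : Continuous F :=
    (((ContinuousLinearMap.smulRightL ℂ H H).continuous.comp
      ((innerSL ℂ).continuous.comp (hU z))).clm_apply (hU z))
  -- The average of the rank-one operators of the orbit of `z` is compact, symmetric, commutes with
  -- `U`, and is nonzero because `⟪z, T z⟫ > 0`. An irreducible subspace of a finite-dimensional
  -- eigenspace with eigenvalue `c ≠ 0` would be orthogonal to the whole orbit, hence annihilated by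
  -- `T`: a contradiction.
  set T : H →L[ℂ] H := ∫ g, F g ∂μ with hT
  have hTin : ∀ x y, ⟪x, T y⟫_ℂ =
      ∫ g, ⟪(U g : H →L[ℂ] H) z, y⟫_ℂ * ⟪x, (U g : H →L[ℂ] H) z⟫_ℂ ∂μ := by
    intro x y
    rw [hT, inner_integral_clm_apply hFc]
    simp only [hF, InnerProductSpace.rankOne_apply, inner_smul_right]
  have hTcomp : IsCompactOperator T := by
    have hconv : Convex ℝ {S : H →L[ℂ] H | IsCompactOperator S} :=
      ((compactOperator (RingHom.id ℂ) H H).restrictScalars ℝ).convex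
    refine hconv.integral_mem isClosed_setOfPred_isCompactOperator
      (Filter.Eventually.of_forall fun g => ?_) (integrable_of_continuous hFc)
    exact (isCompactOperator_id.clm_comp (ContinuousLinearMap.toSpanSingleton ℂ
      ((U g : H →L[ℂ] H) z))).comp_clm (innerSL ℂ ((U g : H →L[ℂ] H) z))
  have hTsymm : (T : H →ₗ[ℂ] H).IsSymmetric := by
    intro x y
    rw [← inner_conj_symm]
    change starRingEnd ℂ ⟪y, T x⟫_ℂ = ⟪x, T y⟫_ℂ
    rw [hTin, hTin, ← integral_conj]
    refine integral_congr_ae (Filter.Eventually.of_forall fun g => ?_)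
    simp only [map_mul, inner_conj_symm]
    ring
  have hTcomm : ∀ g x, T ((U g : H →L[ℂ] H) x) = (U g : H →L[ℂ] H) (T x) := by
    intro g x
    refine ext_inner_left ℂ fun y => ?_
    rw [inner_unitaryRep_right, hTin, hTin, ← integral_mul_left_eq_self _ g]
    simp only [unitaryRep_mul_apply]
    refine integral_congr_ae (Filter.Eventually.of_forall fun k => ?_)
    simp only
    rw [inner_unitaryRep_left, inner_unitaryRep_right U g y, ← unitaryRep_mul_apply,
      inv_mul_cancel, unitaryRep_one_apply]
  have hT0 : T ≠ 0 := by
    intro h0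
    have h1 : ⟪z, T z⟫_ℂ = 0 := by rw [h0]; simp
    rw [hTin] at h1
    have h2 : ∀ g, ⟪(U g : H →L[ℂ] H) z, z⟫_ℂ * ⟪z, (U g : H →L[ℂ] H) z⟫_ℂ =
        ((‖⟪z, (U g : H →L[ℂ] H) z⟫_ℂ‖ ^ 2 : ℝ) : ℂ) := by
      intro g
      rw [← inner_conj_symm, RCLike.conj_mul]; push_cast; rfl
    simp only [h2] at h1
    rw [integral_complex_ofReal, Complex.ofReal_eq_zero] at h1
    have hc : Continuous fun g => ‖⟪z, (U g : H →L[ℂ] H) z⟫_ℂ‖ ^ 2 :=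
      ((continuous_const.inner (hU z)).norm.pow 2)
    have h3 : 0 < ∫ g, ‖⟪z, (U g : H →L[ℂ] H) z⟫_ℂ‖ ^ 2 ∂μ :=
      hc.integral_pos_of_hasCompactSupport_nonneg_nonzero (x := 1)
        (HasCompactSupport.of_compactSpace _) (fun g => by positivity) (by
          rw [unitaryRep_one_apply]; simpa using hz)
    exact h3.ne' h1
  have : ∃ c, Module.End.HasEigenvalue (T : Module.End ℂ H) c ∧ c ≠ 0 := by
    by_contra! hcon
    exact hT0 ((T.eq_zero_of_forall_hasEigenvalue_eq_zero hTcomp hTsymm).1 hcon)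
  obtain ⟨c, hc, hc0⟩ := this
  have hfin := ContinuousLinearMap.finite_dimensional_eigenspace hTcomp c hc0
  obtain ⟨n, σ, J, hσ, hσi, hJE, hJ⟩ := exists_irreducible_intertwiner U hU
    (Module.End.eigenspace (T : Module.End ℂ H) c) hc fun g x hx => by
      rw [Module.End.mem_eigenspace_iff] at hx ⊢
      change T x = c • x at hx
      change T _ = _
      rw [hTcomm, hx, map_smul]
  have := hσi.1
  obtain ⟨v, hv⟩ := exists_ne (0 : EuclideanSpace ℂ (Fin n))
  have h1 : ∀ g, ⟪J v, (U g : H →L[ℂ] H) z⟫_ℂ = 0 := fun g => by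
    rw [inner_unitaryRep_right, hJ]
    exact h n σ J hσ hσi hJ _
  have h2 : ⟪J v, T (J v)⟫_ℂ = 0 := by
    rw [hTin]; simp [h1]
  have h3 : T (J v) = c • J v := Module.End.mem_eigenspace_iff.1 (hJE v)
  rw [h3, inner_smul_right, J.inner_map_map] at h2
  simp [hc0, hv] at h2

end CompactGroups

/-! ### The regular representation and the Peter–Weyl theorem -/

section RegularRepresentation

variable {G : Type*} [Group G] [TopologicalSpace G] [IsTopologicalGroup G] [CompactSpace G]
  [MeasurableSpace G] [BorelSpace G] (μ : Measure G) [IsProbabilityMeasure μ] [μ.IsHaarMeasure]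

/-- Left translation by `g` on `L²(G)`. -/
def leftTranslation (g : G) : Lp ℂ 2 μ →ₗᵢ[ℂ] Lp ℂ 2 μ where
  toFun f := DomMulAct.mk g⁻¹ • f
  map_add' f k := smul_add _ f k
  map_smul' c f := smul_comm _ c f
  norm_map' f := DomMulAct.norm_smul_Lp _ f

omit [CompactSpace G] [IsProbabilityMeasure μ] in
theorem leftTranslation_mul (g h : G) (f : Lp ℂ 2 μ) :
    leftTranslation μ (g * h) f = leftTranslation μ g (leftTranslation μ h f) := by
  change DomMulAct.mk (g * h)⁻¹ • f = DomMulAct.mk g⁻¹ • DomMulAct.mk h⁻¹ • f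
  rw [smul_smul, ← DomMulAct.mk_mul, mul_inv_rev]

omit [CompactSpace G] [IsProbabilityMeasure μ] in
theorem leftTranslation_one (f : Lp ℂ 2 μ) : leftTranslation μ 1 f = f := by
  change DomMulAct.mk (1 : G)⁻¹ • f = f
  rw [inv_one, DomMulAct.mk_one, one_smul]

/-- The left regular representation of a compact group. -/
def regularRep : G →* unitary (Lp ℂ 2 μ →L[ℂ] Lp ℂ 2 μ) :=
  unitaryRepOfStar (fun g => (leftTranslation μ g).toContinuousLinearMap)
    (by ext1 f; exact leftTranslation_one μ f)
    (fun g h => by ext1 f; exact leftTranslation_mul μ g h f)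
    (fun g => by
      symm
      refine (ContinuousLinearMap.eq_adjoint_iff _ _).2 fun x y => ?_
      change ⟪leftTranslation μ g⁻¹ x, y⟫_ℂ = ⟪x, leftTranslation μ g y⟫_ℂ
      rw [← (leftTranslation μ g).inner_map_map (leftTranslation μ g⁻¹ x) y,
        ← leftTranslation_mul, mul_inv_cancel, leftTranslation_one])

omit [CompactSpace G] [IsProbabilityMeasure μ] in
theorem regularRep_apply (g : G) (f : Lp ℂ 2 μ) :
    (regularRep μ g : Lp ℂ 2 μ →L[ℂ] Lp ℂ 2 μ) f = DomMulAct.mk g⁻¹ • f := rfl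

theorem isContinuousUnitaryRep_regularRep : IsContinuousUnitaryRep (regularRep μ) := by
  intro f
  have : Fact ((2 : ENNReal) ≠ ⊤) := ⟨ENNReal.ofNat_ne_top⟩
  simp only [regularRep_apply]
  exact ((DomMulAct.mkHomeomorph.continuous.comp continuous_inv).smul continuous_const)

variable {μ}

/-- **Peter–Weyl theorem**: a continuous function orthogonal to the matrix coefficients of all
irreducible representations vanishes. -/
theorem eq_zero_of_integral_mul_coeff_eq_zero {f : G → ℂ} (hf : Continuous f)
    (h : ∀ (n : ℕ) (σ : G →* unitary (EuclideanSpace ℂ (Fin n) →L[ℂ] EuclideanSpace ℂ (Fin n))),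
      IsContinuousUnitaryRep σ →
      ActsIrreducibly (Set.range fun g =>
        (σ g : EuclideanSpace ℂ (Fin n) →L[ℂ] EuclideanSpace ℂ (Fin n))) →
      ∀ v w, ∫ g, f g *
        ⟪v, (σ g : EuclideanSpace ℂ (Fin n) →L[ℂ] EuclideanSpace ℂ (Fin n)) w⟫_ℂ ∂μ = 0) :
    f = 0 := by
  set R := regularRep μ with hR
  have hRc : IsContinuousUnitaryRep R := isContinuousUnitaryRep_regularRep μ
  -- Orthogonality to irreducible coefficients passes to all coefficients of `R`: the vector `∫ conj
  -- (f g) R(g⁻¹) v dg` is orthogonal to every irreducible subspace, so it vanishes.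
  have step1 : ∀ v w : Lp ℂ 2 μ, ∫ g, f g * ⟪v, (R g : Lp ℂ 2 μ →L[ℂ] Lp ℂ 2 μ) w⟫_ℂ ∂μ = 0 := by
    intro v w
    have hc : Continuous fun g => starRingEnd ℂ (f g) • (R g⁻¹ : Lp ℂ 2 μ →L[ℂ] Lp ℂ 2 μ) v :=
      (Complex.continuous_conj.comp hf).smul ((hRc v).comp continuous_inv)
    have hz : ∀ w, ⟪w, ∫ g, starRingEnd ℂ (f g) • (R g⁻¹ : Lp ℂ 2 μ →L[ℂ] Lp ℂ 2 μ) v ∂μ⟫_ℂ =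
        starRingEnd ℂ (∫ g, f g * ⟪v, (R g : Lp ℂ 2 μ →L[ℂ] Lp ℂ 2 μ) w⟫_ℂ ∂μ) := by
      intro w
      rw [← integral_inner (integrable_of_continuous hc), ← integral_conj]
      refine integral_congr_ae (Filter.Eventually.of_forall fun g => ?_)
      simp only [inner_smul_right, map_mul]
      rw [inner_conj_symm, inner_unitaryRep_left]
    have hz0 := eq_zero_of_orthogonal_intertwiners (μ := μ) R hRc
      (∫ g, starRingEnd ℂ (f g) • (R g⁻¹ : Lp ℂ 2 μ →L[ℂ] Lp ℂ 2 μ) v ∂μ)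
      fun n σ J hσ hσi hJ u => by
        rw [hz]
        simp only [hJ]
        have := h n σ hσ hσi (ContinuousLinearMap.adjoint J.toContinuousLinearMap v) u
        simp only [ContinuousLinearMap.adjoint_inner_left] at this
        rw [← map_zero (starRingEnd ℂ), ← this]
        rfl
    have := hz w
    rw [hz0, inner_zero_right, eq_comm, map_eq_zero] at this
    exact this
  have hmem : ∀ {k : G → ℂ}, Continuous k → MemLp k 2 μ := by
    intro k hk
    obtain ⟨C, hC⟩ := (isCompact_range hk).isBounded.exists_norm_le
    exact MemLp.of_bound (integrable_of_continuous hk).aestronglyMeasurable C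
      (Filter.Eventually.of_forall fun x => hC _ ⟨x, rfl⟩)
  have hinner : ∀ {k l : G → ℂ} (hk : Continuous k) (hl : Continuous l),
      ⟪(hmem hk).toLp, (hmem hl).toLp⟫_ℂ = ∫ x, starRingEnd ℂ (k x) * l x ∂μ := by
    intro k l hk hl
    rw [L2.inner_def]
    refine integral_congr_ae ?_
    filter_upwards [(hmem hk).coeFn_toLp, (hmem hl).coeFn_toLp] with x hx hx'
    rw [hx, hx', RCLike.inner_apply, mul_comm]
  have htrans : ∀ {k : G → ℂ} (hk : Continuous k) (g : G),
      (R g : Lp ℂ 2 μ →L[ℂ] Lp ℂ 2 μ) (hmem hk).toLp =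
        (hmem (hk.comp (continuous_const_mul g⁻¹))).toLp := fun hk g =>
    DomMulAct.mk_smul_toLp _ _
  set F : Lp ℂ 2 μ := (hmem hf).toLp with hF
  set Φ : G → ℂ := fun x => ⟪(R x : Lp ℂ 2 μ →L[ℂ] Lp ℂ 2 μ) F, F⟫_ℂ with hΦ
  have hΦc : Continuous Φ := (hRc F).inner continuous_const
  have hΦi : ∀ x, Φ x = ∫ g, starRingEnd ℂ (f (x⁻¹ * g)) * f g ∂μ := fun x => by
    simp only [hΦ, hF]
    rw [htrans hf, hinner (hf.comp (continuous_const_mul _)) hf]; rfl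
  -- For `φ(x) = conj (f(x⁻¹))` one has `∫ f(g) φ(g⁻¹ x) dg = Φ(x)`. The coefficient of `R` between
  -- `Φ` and `φ`, integrated against `f`, is therefore `‖Φ‖²`, while `Φ(1) = ‖F‖²`.
  have hφ : Continuous fun x => starRingEnd ℂ (f x⁻¹) :=
    Complex.continuous_conj.comp (hf.comp continuous_inv)
  have h2 := step1 (hmem hΦc).toLp (hmem hφ).toLp
  have h2' : ∀ g, ⟪(hmem hΦc).toLp, (R g : Lp ℂ 2 μ →L[ℂ] Lp ℂ 2 μ) (hmem hφ).toLp⟫_ℂ =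
      ∫ x, starRingEnd ℂ (Φ x) * starRingEnd ℂ (f (g⁻¹ * x)⁻¹) ∂μ := fun g => by
    rw [htrans hφ, hinner hΦc (hφ.comp (continuous_const_mul _))]; rfl
  simp only [h2', ← integral_const_mul] at h2
  have hcs : Continuous (Function.uncurry fun g x =>
      f g * (starRingEnd ℂ (Φ x) * starRingEnd ℂ (f (g⁻¹ * x)⁻¹))) := by
    simp only [Function.uncurry_def]
    have := Complex.continuous_conj
    fun_prop
  rw [integral_integral_swap_of_hasCompactSupport hcs (HasCompactSupport.of_compactSpace _)] at h2
  have h3 : ∀ x, ∫ g, f g * (starRingEnd ℂ (Φ x) * starRingEnd ℂ (f (g⁻¹ * x)⁻¹)) ∂μ =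
      starRingEnd ℂ (Φ x) * Φ x := by
    intro x
    rw [hΦi x, ← integral_const_mul, ← hΦi x]
    refine integral_congr_ae (Filter.Eventually.of_forall fun g => ?_)
    simp only [mul_inv_rev, inv_inv]
    ring
  simp only [h3] at h2
  rw [← hinner hΦc hΦc, inner_self_eq_zero] at h2
  have hΦ0 : Φ = 0 := by
    refine (hΦc.ae_eq_iff_eq μ continuous_zero).1 ?_
    have := (hmem hΦc).coeFn_toLp
    rw [h2] at this
    exact this.symm.trans (Lp.coeFn_zero ..)
  have h4 := congrFun hΦ0 1
  simp only [hΦ, unitaryRep_one_apply, Pi.zero_apply, inner_self_eq_zero] at h4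
  refine (hf.ae_eq_iff_eq μ continuous_zero).1 ?_
  have := (hmem hf).coeFn_toLp
  rw [← hF, h4] at this
  exact this.symm.trans (Lp.coeFn_zero ..)

end RegularRepresentation

/-! ### The induced action on operators -/

section Conjugation

variable {G : Type*} [Group G]
  {H : Type*} [NormedAddCommGroup H] [InnerProductSpace ℂ H] [CompleteSpace H]
  {U : G →* unitary (H →L[ℂ] H)}

theorem conjBy_apply (g : G) (S : H →L[ℂ] H) (x : H) :
    conjBy U g S x = (U g : H →L[ℂ] H) (S ((U g⁻¹ : H →L[ℂ] H) x)) := by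
  rw [← star_unitaryRep]; rfl

theorem conjBy_eq_conjStarAlgAut (g : G) (S : H →L[ℂ] H) :
    conjBy U g S = Unitary.conjStarAlgAut ℂ (H →L[ℂ] H) (U g) S :=
  (Unitary.conjStarAlgAut_apply _ _).symm

theorem conjBy_mul (g : G) (S T : H →L[ℂ] H) :
    conjBy U g (S * T) = conjBy U g S * conjBy U g T := by
  simp only [conjBy_eq_conjStarAlgAut, map_mul]

theorem conjBy_star (g : G) (S : H →L[ℂ] H) : conjBy U g (star S) = star (conjBy U g S) := by
  simp only [conjBy, star_mul, star_star, mul_assoc]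

theorem conjBy_sum {ι : Type*} (s : Finset ι) (g : G) (S : ι → H →L[ℂ] H) :
    conjBy U g (∑ i ∈ s, S i) = ∑ i ∈ s, conjBy U g (S i) := by
  simp only [conjBy_eq_conjStarAlgAut, map_sum]

theorem conjBy_smul (g : G) (c : ℂ) (S : H →L[ℂ] H) :
    conjBy U g (c • S) = c • conjBy U g S := by
  simp only [conjBy_eq_conjStarAlgAut, map_smul]

theorem conjBy_one (g : G) : conjBy U g (1 : H →L[ℂ] H) = 1 := by
  rw [conjBy_eq_conjStarAlgAut, map_one]

theorem conjBy_conjBy (g h : G) (S : H →L[ℂ] H) :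
    conjBy U g (conjBy U h S) = conjBy U (g * h) S := by
  ext x
  simp only [conjBy_apply, mul_inv_rev, unitaryRep_mul_apply]

theorem conjBy_identity (S : H →L[ℂ] H) : conjBy U 1 S = S := by
  ext x
  simp only [conjBy_apply, inv_one, unitaryRep_one_apply]

/-- The vector `x` is invariant under the representation `U`. -/
def IsFixedVector (U : G →* unitary (H →L[ℂ] H)) (x : H) : Prop :=
  ∀ g, (U g : H →L[ℂ] H) x = x

theorem IsFixedVector.apply_of_conjBy_eq {x : H} (hx : IsFixedVector U x) {A : H →L[ℂ] H}
    (hA : ∀ g, conjBy U g A = A) : IsFixedVector U (A x) := by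
  intro g
  conv_rhs => rw [← hA g, conjBy_apply, hx]

end Conjugation

/-! ### Sums over orthonormal bases -/

section FiniteSums

variable {n : ℕ} {X : Type*} [NonUnitalRing X] [StarRing X] [Module ℂ X] [StarModule ℂ X]
  [IsScalarTower ℂ X X] [SMulCommClass ℂ X X]

omit [StarRing X] [StarModule ℂ X] [IsScalarTower ℂ X X] [SMulCommClass ℂ X X] in
theorem sum_inner_smul_basis (L : EuclideanSpace ℂ (Fin n) →ₗ[ℂ] X)
    (v : EuclideanSpace ℂ (Fin n)) :
    ∑ i, ⟪EuclideanSpace.basisFun (Fin n) ℂ i, v⟫_ℂ • L (EuclideanSpace.basisFun (Fin n) ℂ i) =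
      L v := by
  conv_rhs => rw [← (EuclideanSpace.basisFun (Fin n) ℂ).sum_repr' v]
  simp only [map_sum, map_smul]

/-- The sum `∑ L(eᵢ) M(eᵢ)*` over an orthonormal basis is invariant under unitaries. -/
theorem sum_mul_star_unitary (L M : EuclideanSpace ℂ (Fin n) →ₗ[ℂ] X)
    {u : EuclideanSpace ℂ (Fin n) →L[ℂ] EuclideanSpace ℂ (Fin n)} (hu : u * star u = 1) :
    ∑ i, L (u (EuclideanSpace.basisFun (Fin n) ℂ i)) *
        star (M (u (EuclideanSpace.basisFun (Fin n) ℂ i))) =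
      ∑ i, L (EuclideanSpace.basisFun (Fin n) ℂ i) *
        star (M (EuclideanSpace.basisFun (Fin n) ℂ i)) := by
  set e := EuclideanSpace.basisFun (Fin n) ℂ with he
  have h1 : ∀ i, L (u (e i)) * star (M (u (e i))) =
      ∑ k, ∑ l, (⟪e k, u (e i)⟫_ℂ * starRingEnd ℂ ⟪e l, u (e i)⟫_ℂ) • (L (e k) * star (M (e l))) := by
    intro i
    rw [← sum_inner_smul_basis L (u (e i)), ← sum_inner_smul_basis M (u (e i)), star_sum,
      Finset.sum_mul_sum]
    simp only [star_smul, smul_mul_smul_comm]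
    rfl
  have h2 : ∀ k l, ∑ i, ⟪e k, u (e i)⟫_ℂ * starRingEnd ℂ ⟪e l, u (e i)⟫_ℂ =
      if k = l then 1 else 0 := by
    intro k l
    have : ∀ i, ⟪e k, u (e i)⟫_ℂ * starRingEnd ℂ ⟪e l, u (e i)⟫_ℂ =
        ⟪star u (e k), e i⟫_ℂ * ⟪e i, star u (e l)⟫_ℂ := by
      intro i
      rw [inner_conj_symm, ContinuousLinearMap.star_eq_adjoint,
        ContinuousLinearMap.adjoint_inner_left, ContinuousLinearMap.adjoint_inner_right]
    simp only [this]
    rw [e.sum_inner_mul_inner, ContinuousLinearMap.star_eq_adjoint,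
      ContinuousLinearMap.adjoint_inner_left, ← ContinuousLinearMap.star_eq_adjoint,
      ← mul_apply_eq_comp, hu, one_apply_eq_self, orthonormal_iff_ite.1 e.orthonormal]
  simp only [h1]
  rw [Finset.sum_comm]
  refine Finset.sum_congr rfl fun k _ => ?_
  rw [Finset.sum_comm]
  simp only [← Finset.sum_smul, h2]
  simp

end FiniteSums

/-! ### Multiplets: irreducible Hilbert spaces in `B` -/

section Multiplets

variable {G : Type*} [Group G] [TopologicalSpace G]
  {H : Type*} [NormedAddCommGroup H] [InnerProductSpace ℂ H] [CompleteSpace H]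
  {U : G →* unitary (H →L[ℂ] H)} {B : NonUnitalStarSubalgebra ℂ (H →L[ℂ] H)} {n : ℕ}
  {σ : G →* unitary (EuclideanSpace ℂ (Fin n) →L[ℂ] EuclideanSpace ℂ (Fin n))}

/-- The algebra `B` contains, as the image of `T`, a Hilbert space of operators on which the action
induced by `U` is equivalent to `σ`. -/
structure IsMultiplet (U : G →* unitary (H →L[ℂ] H)) {B : NonUnitalStarSubalgebra ℂ (H →L[ℂ] H)}
    (σ : G →* unitary (EuclideanSpace ℂ (Fin n) →L[ℂ] EuclideanSpace ℂ (Fin n)))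
    (T : EuclideanSpace ℂ (Fin n) →ₗ[ℂ] B) : Prop where
  star_mul : ∀ v w, star (T v : H →L[ℂ] H) * (T w : H →L[ℂ] H) = ⟪v, w⟫_ℂ • (1 : H →L[ℂ] H)
  equivariant : ∀ g v, conjBy U g (T v : H →L[ℂ] H) =
    T ((σ g : EuclideanSpace ℂ (Fin n) →L[ℂ] EuclideanSpace ℂ (Fin n)) v)

theorem HasFullHilbertSpectrum.exists_isMultiplet (h : HasFullHilbertSpectrum U B)
    (hσ : IsContinuousUnitaryRep σ)
    (hσi : ActsIrreducibly (Set.range fun g =>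
      (σ g : EuclideanSpace ℂ (Fin n) →L[ℂ] EuclideanSpace ℂ (Fin n)))) :
    ∃ T : EuclideanSpace ℂ (Fin n) →ₗ[ℂ] B, IsMultiplet U σ T := by
  obtain ⟨E, hE, T, h1, h2⟩ := h n σ hσ hσi
  exact ⟨{ toFun := fun v => ⟨T v, hE.mem _ (T v).2⟩
           map_add' := fun v w => Subtype.ext (by simp)
           map_smul' := fun c v => Subtype.ext (by simp) }, h1, h2⟩

/-- The trivial one-dimensional representation is realized by multiples of an isometry `ψ ∈ B`, and
`ψ* ψ = 1`; `B` is not assumed to be unital. -/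
theorem HasFullHilbertSpectrum.one_mem (h : HasFullHilbertSpectrum U B) :
    (1 : H →L[ℂ] H) ∈ B := by
  obtain ⟨T, hT⟩ := h.exists_isMultiplet (n := 1) (σ := 1) (fun x => continuous_const)
    ⟨inferInstance, fun M _ _ => or_iff_not_imp_left.2 fun hM => by
      have := (Submodule.one_le_finrank_iff (S := M)).2 hM
      refine Submodule.eq_top_of_finrank_eq (le_antisymm (Submodule.finrank_le _) ?_)
      simpa using this⟩
  have := hT.star_mul (EuclideanSpace.single 0 1) (EuclideanSpace.single 0 1)
  rw [inner_self_eq_norm_sq_to_K] at this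
  simp only [EuclideanSpace.single, PiLp.norm_single, norm_one] at this
  simp only [RCLike.ofReal_one, one_pow, one_smul] at this
  rw [← this]
  exact mul_mem (star_mem (T _).2) (T _).2

/-- The sum `∑ L(eᵢ) ψᵢ*` over an orthonormal basis of a multiplet. -/
def multipletSum (L T : EuclideanSpace ℂ (Fin n) →ₗ[ℂ] B) : B :=
  ∑ i, L (EuclideanSpace.basisFun (Fin n) ℂ i) * star (T (EuclideanSpace.basisFun (Fin n) ℂ i))

theorem coe_multipletSum (L T : EuclideanSpace ℂ (Fin n) →ₗ[ℂ] B) :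
    (multipletSum L T : H →L[ℂ] H) = ∑ i, (L (EuclideanSpace.basisFun (Fin n) ℂ i) : H →L[ℂ] H) *
      star (T (EuclideanSpace.basisFun (Fin n) ℂ i) : H →L[ℂ] H) := by
  rw [multipletSum, AddSubmonoidClass.coe_finsetSum]; rfl

-- The action replaces the basis by its image under the unitary `σ g` in both factors at once, and
-- the sum does not depend on the orthonormal basis.
omit [TopologicalSpace G] in
theorem multipletSum_mem_fixedPointAlgebra {L T : EuclideanSpace ℂ (Fin n) →ₗ[ℂ] B}
    (hL : ∀ g v, conjBy U g (L v : H →L[ℂ] H) =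
      L ((σ g : EuclideanSpace ℂ (Fin n) →L[ℂ] EuclideanSpace ℂ (Fin n)) v))
    (hT : ∀ g v, conjBy U g (T v : H →L[ℂ] H) =
      T ((σ g : EuclideanSpace ℂ (Fin n) →L[ℂ] EuclideanSpace ℂ (Fin n)) v)) :
    (multipletSum L T : H →L[ℂ] H) ∈ fixedPointAlgebra U B := by
  refine ⟨(multipletSum L T).2, fun g => ?_⟩
  rw [coe_multipletSum, conjBy_sum]
  simp only [conjBy_mul, conjBy_star, hL, hT]
  have := sum_mul_star_unitary L T (Unitary.coe_mul_star_self (σ g))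
  have := congrArg (fun b : B => (b : H →L[ℂ] H)) this
  simpa only [AddSubmonoidClass.coe_finsetSum] using! this

-- Since `ψᵢ* T v = ⟪eᵢ, v⟫`, right multiplication by `T v` collapses the sum to the basis expansion
-- of `L v`. Any `L` thus factors through the multiplet `T`.
omit [TopologicalSpace G] in
theorem IsMultiplet.multipletSum_mul {T : EuclideanSpace ℂ (Fin n) →ₗ[ℂ] B}
    (hT : IsMultiplet U σ T) (L : EuclideanSpace ℂ (Fin n) →ₗ[ℂ] B)
    (v : EuclideanSpace ℂ (Fin n)) : multipletSum L T * T v = L v := by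
  ext1
  rw [← sum_inner_smul_basis L v, MulMemClass.coe_mul, coe_multipletSum, Finset.sum_mul,
    AddSubmonoidClass.coe_finsetSum]
  refine Finset.sum_congr rfl fun i _ => ?_
  rw [mul_assoc, hT.star_mul, mul_smul_comm, mul_one]
  rfl

end Multiplets

/-! ### Haar averages and spectral components -/

section Averages

variable {G : Type*} [Group G] [TopologicalSpace G] [IsTopologicalGroup G] [CompactSpace G]
  [MeasurableSpace G] [BorelSpace G] {μ : Measure G} [IsProbabilityMeasure μ]
  {H : Type*} [NormedAddCommGroup H] [InnerProductSpace ℂ H] [CompleteSpace H]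
  {K : Type*} [NormedAddCommGroup K] [InnerProductSpace ℂ K] [CompleteSpace K]
  {U : G →* unitary (H →L[ℂ] H)} {B : NonUnitalStarSubalgebra ℂ (H →L[ℂ] H)} {n : ℕ}
  {σ : G →* unitary (EuclideanSpace ℂ (Fin n) →L[ℂ] EuclideanSpace ℂ (Fin n))}

/-- The automorphism of `B` induced by `U g`. -/
def InducesAction.act (hα : InducesAction U B) (g : G) (b : B) : B :=
  ⟨conjBy U g b, hα.mem g b b.2⟩

omit [IsTopologicalGroup G] [CompactSpace G] [MeasurableSpace G] [BorelSpace G] in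
theorem InducesAction.continuous_act (hα : InducesAction U B) (b : B) :
    Continuous fun g => hα.act g b :=
  (hα.continuous b b.2).subtype_mk _

omit [IsTopologicalGroup G] [CompactSpace G] [MeasurableSpace G] [BorelSpace G] in
theorem InducesAction.act_one (hα : InducesAction U B) (b : B) : hα.act 1 b = b :=
  Subtype.ext (conjBy_identity _)

theorem norm_map_le_of_isClosed (hB : IsClosed (B : Set (H →L[ℂ] H))) (π : B →⋆ₙₐ[ℂ] (K →L[ℂ] K))
    (b : B) : ‖π b‖ ≤ ‖(b : H →L[ℂ] H)‖ :=
  NonUnitalStarAlgHom.norm_apply_le π b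

/-- A representation of a norm-closed algebra of operators as a continuous linear map. -/
def representationCLM (hB : IsClosed (B : Set (H →L[ℂ] H))) (π : B →⋆ₙₐ[ℂ] (K →L[ℂ] K)) :
    B →L[ℂ] (K →L[ℂ] K) :=
  LinearMap.mkContinuous
    { toFun := π
      map_add' := map_add π
      map_smul' := fun c b => map_smul π c b } 1 fun b => by
    rw [one_mul]; exact norm_map_le_of_isClosed hB π b

variable (B) in
/-- The inclusion of an algebra of operators as a continuous linear map. -/
def inclusionCLM : B →L[ℂ] (H →L[ℂ] H) where
  toFun b := b
  map_add' _ _ := rfl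
  map_smul' _ _ := rfl
  cont := continuous_subtype_val

omit [Group G] [IsTopologicalGroup G] in
theorem coe_integral (hB : IsClosed (B : Set (H →L[ℂ] H))) {F : G → B} (hF : Continuous F) :
    ((∫ g, F g ∂μ : B) : H →L[ℂ] H) = ∫ g, (F g : H →L[ℂ] H) ∂μ := by
  have : CompleteSpace B := hB.completeSpace_coe
  exact ((inclusionCLM B).integral_comp_comm (integrable_of_continuous hF)).symm

omit [Group G] [IsTopologicalGroup G] in
theorem inner_coe_integral_apply (hB : IsClosed (B : Set (H →L[ℂ] H))) {F : G → B}
    (hF : Continuous F) (x y : H) :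
    ⟪x, ((∫ g, F g ∂μ : B) : H →L[ℂ] H) y⟫_ℂ = ∫ g, ⟪x, (F g : H →L[ℂ] H) y⟫_ℂ ∂μ := by
  rw [coe_integral hB hF,
    inner_integral_clm_apply (F := fun g => (F g : H →L[ℂ] H)) (continuous_subtype_val.comp hF)]

omit [Group G] [IsTopologicalGroup G] in
theorem inner_map_integral_apply (hB : IsClosed (B : Set (H →L[ℂ] H)))
    (π : B →⋆ₙₐ[ℂ] (K →L[ℂ] K)) {F : G → B} (hF : Continuous F) (x y : K) :
    ⟪x, π (∫ g, F g ∂μ) y⟫_ℂ = ∫ g, ⟪x, π (F g) y⟫_ℂ ∂μ := by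
  have : CompleteSpace B := hB.completeSpace_coe
  have h := (representationCLM hB π).integral_comp_comm (integrable_of_continuous (μ := μ) hF)
  change ∫ g, π (F g) ∂μ = π (∫ g, F g ∂μ) at h
  rw [← h, inner_integral_clm_apply (F := fun g => π (F g))
    ((representationCLM hB π).continuous.comp hF)]

omit [IsTopologicalGroup G] in
theorem conjBy_integral (h : G) {F : G → H →L[ℂ] H} (hF : Continuous F) :
    conjBy U h (∫ g, F g ∂μ) = ∫ g, conjBy U h (F g) ∂μ :=
  ((ContinuousLinearMap.mulLeftRight ℂ (H →L[ℂ] H) (U h : H →L[ℂ] H)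
    (star (U h : H →L[ℂ] H))).integral_comp_comm (integrable_of_continuous hF)).symm

omit [IsTopologicalGroup G] [CompactSpace G] [MeasurableSpace G] [BorelSpace G] in
theorem InducesAction.continuous_coeff_smul_act (hα : InducesAction U B)
    (hσ : IsContinuousUnitaryRep σ) (w v : EuclideanSpace ℂ (Fin n)) (c : B) :
    Continuous fun g =>
      ⟪(σ g : EuclideanSpace ℂ (Fin n) →L[ℂ] EuclideanSpace ℂ (Fin n)) w, v⟫_ℂ • hα.act g c := by
  have h1 : Continuous fun g =>
      ⟪(σ g : EuclideanSpace ℂ (Fin n) →L[ℂ] EuclideanSpace ℂ (Fin n)) w, v⟫_ℂ :=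
    (hσ w).inner continuous_const
  exact h1.fun_smul (hα.continuous_act c)

/-- The component `v ↦ ∫ ⟪σ(g) w, v⟫ α_g(c) dg` of `c` in the spectral subspace of `σ`. -/
def spectralComponent (μ : Measure G) [IsProbabilityMeasure μ] (hα : InducesAction U B)
    (hσ : IsContinuousUnitaryRep σ) (w : EuclideanSpace ℂ (Fin n)) (c : B) :
    EuclideanSpace ℂ (Fin n) →ₗ[ℂ] B where
  toFun v := ∫ g, ⟪(σ g : EuclideanSpace ℂ (Fin n) →L[ℂ] EuclideanSpace ℂ (Fin n)) w, v⟫_ℂ •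
    hα.act g c ∂μ
  map_add' v v' := by
    simp only [inner_add_right, add_smul]
    exact integral_add (integrable_of_continuous (hα.continuous_coeff_smul_act hσ w v c))
      (integrable_of_continuous (hα.continuous_coeff_smul_act hσ w v' c))
  map_smul' a v := by
    simp only [inner_smul_right, mul_smul, integral_smul, RingHom.id_apply]

variable [μ.IsHaarMeasure]

/-- Left invariance of the Haar measure: in the translated integrand, the unitary `σ h` cancels from
the coefficient. -/
theorem conjBy_spectralComponent (hB : IsClosed (B : Set (H →L[ℂ] H))) (hα : InducesAction U B)
    (hσ : IsContinuousUnitaryRep σ) (w : EuclideanSpace ℂ (Fin n)) (c : B) (h : G)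
    (v : EuclideanSpace ℂ (Fin n)) :
    conjBy U h (spectralComponent μ hα hσ w c v : H →L[ℂ] H) =
      spectralComponent μ hα hσ w c
        ((σ h : EuclideanSpace ℂ (Fin n) →L[ℂ] EuclideanSpace ℂ (Fin n)) v) := by
  have hc := fun v => hα.continuous_coeff_smul_act hσ w v c
  change conjBy U h ((∫ g, _ ∂μ : B) : H →L[ℂ] H) = ((∫ g, _ ∂μ : B) : H →L[ℂ] H)
  rw [coe_integral hB (hc _), coe_integral hB (hc _),
    conjBy_integral h (F := fun g => ((⟪(σ g : EuclideanSpace ℂ (Fin n) →L[ℂ] _) w, v⟫_ℂ •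
      hα.act g c : B) : H →L[ℂ] H)) (continuous_subtype_val.comp (hc v))]
  conv_rhs => rw [← integral_mul_left_eq_self _ h]
  refine integral_congr_ae (Filter.Eventually.of_forall fun g => ?_)
  change conjBy U h (⟪(σ g : EuclideanSpace ℂ (Fin n) →L[ℂ] _) w, v⟫_ℂ • conjBy U g c) =
    ⟪(σ (h * g) : EuclideanSpace ℂ (Fin n) →L[ℂ] _) w,
      (σ h : EuclideanSpace ℂ (Fin n) →L[ℂ] EuclideanSpace ℂ (Fin n)) v⟫_ℂ • conjBy U (h * g) c
  rw [conjBy_smul, conjBy_conjBy, unitaryRep_mul_apply, inner_unitaryRep_left σ h,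
    ← unitaryRep_mul_apply, inv_mul_cancel, unitaryRep_one_apply]

/-- The mean `∫ α_g(b) dg`. -/
def InducesAction.mean (μ : Measure G) (hα : InducesAction U B) (b : B) : B :=
  ∫ g, hα.act g b ∂μ

theorem InducesAction.mean_mem (hB : IsClosed (B : Set (H →L[ℂ] H))) (hα : InducesAction U B)
    (b : B) : (hα.mean μ b : H →L[ℂ] H) ∈ fixedPointAlgebra U B := by
  refine ⟨(hα.mean μ b).2, fun h => ?_⟩
  rw [InducesAction.mean, coe_integral hB (hα.continuous_act b),
    conjBy_integral h (F := fun g => ((hα.act g b : B) : H →L[ℂ] H))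
      (continuous_subtype_val.comp (hα.continuous_act b)),
    ← integral_mul_left_eq_self (fun g => ((hα.act g b : B) : H →L[ℂ] H)) h]
  refine integral_congr_ae (Filter.Eventually.of_forall fun g => ?_)
  exact conjBy_conjBy h g (b : H →L[ℂ] H)

/-- A spectral component transforms like the multiplet `T`, so `A = ∑ L(eᵢ) ψᵢ*` is a fixed point
with `L v = A T v`. This is how information about `B^G` and about multiplets combines to information
about `B`. -/
theorem spectralComponent_eq_mul {T : EuclideanSpace ℂ (Fin n) →ₗ[ℂ] B} (hT : IsMultiplet U σ T)
    (hB : IsClosed (B : Set (H →L[ℂ] H))) (hα : InducesAction U B)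
    (hσ : IsContinuousUnitaryRep σ) (w : EuclideanSpace ℂ (Fin n)) (c : B) :
    ∃ A : B, (A : H →L[ℂ] H) ∈ fixedPointAlgebra U B ∧
      ∀ v, spectralComponent μ hα hσ w c v = A * T v := by
  have hL := conjBy_spectralComponent (μ := μ) hB hα hσ w c
  generalize spectralComponent μ hα hσ w c = L at hL ⊢
  exact ⟨multipletSum L T, multipletSum_mem_fixedPointAlgebra hL hT.equivariant,
    fun v => (hT.multipletSum_mul L v).symm⟩

omit [TopologicalSpace G] [IsTopologicalGroup G] [CompactSpace G] [MeasurableSpace G]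
  [BorelSpace G] in
/-- A fixed vector of a nontrivial irreducible representation vanishes. -/
theorem eq_zero_of_isFixedVector
    (hσi : ActsIrreducibly (Set.range fun g => (σ g : EuclideanSpace ℂ (Fin n) →L[ℂ] _)))
    (hne : ∃ g, σ g ≠ 1) {p : EuclideanSpace ℂ (Fin n)} (hp : IsFixedVector σ p) : p = 0 := by
  obtain ⟨g₀, hg₀⟩ := hne
  set M : Submodule ℂ (EuclideanSpace ℂ (Fin n)) :=
    { carrier := {p | IsFixedVector σ p}
      add_mem' := fun {a b} ha hb g => by rw [map_add, ha g, hb g]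
      zero_mem' := fun g => map_zero _
      smul_mem' := fun c a ha g => by rw [map_smul, ha g] } with hM
  rcases hσi.2 M M.closed_of_finiteDimensional (by
    rintro _ ⟨g, rfl⟩ x hx
    have : (σ g : EuclideanSpace ℂ (Fin n) →L[ℂ] _) x = x := hx g
    simpa only [this] using hx) with h | h
  · have : p ∈ M := hp
    rwa [h, Submodule.mem_bot] at this
  · refine absurd (Subtype.ext ?_) hg₀
    ext1 x
    have : x ∈ M := by rw [h]; trivial
    exact this g₀

theorem integral_eq_zero_of_nontrivial (hσ : IsContinuousUnitaryRep σ)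
    (hσi : ActsIrreducibly (Set.range fun g => (σ g : EuclideanSpace ℂ (Fin n) →L[ℂ] _)))
    (hne : ∃ g, σ g ≠ 1) (w : EuclideanSpace ℂ (Fin n)) :
    ∫ g, (σ g : EuclideanSpace ℂ (Fin n) →L[ℂ] EuclideanSpace ℂ (Fin n)) w ∂μ = 0 := by
  refine eq_zero_of_isFixedVector hσi hne fun h => ?_
  rw [← ContinuousLinearMap.integral_comp_comm _ (integrable_of_continuous (hσ w))]
  conv_rhs => rw [← integral_mul_left_eq_self _ h]
  simp only [unitaryRep_mul_apply]

/-- A continuous function is constant if it is orthogonal to the matrix coefficients of all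
nontrivial irreducible representations. -/
theorem eq_integral_of_coeff_eq_zero {f : G → ℂ} (hf : Continuous f)
    (h : ∀ (n : ℕ) (σ : G →* unitary (EuclideanSpace ℂ (Fin n) →L[ℂ] EuclideanSpace ℂ (Fin n))),
      IsContinuousUnitaryRep σ →
      ActsIrreducibly (Set.range fun g =>
        (σ g : EuclideanSpace ℂ (Fin n) →L[ℂ] EuclideanSpace ℂ (Fin n))) → (∃ g, σ g ≠ 1) →
      ∀ v w, ∫ g, f g *
        ⟪(σ g : EuclideanSpace ℂ (Fin n) →L[ℂ] EuclideanSpace ℂ (Fin n)) w, v⟫_ℂ ∂μ = 0) (g : G) :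
    f g = ∫ g, f g ∂μ := by
  set I := ∫ g, f g ∂μ with hI
  have hc : Continuous fun g => starRingEnd ℂ (f g - I) :=
    Complex.continuous_conj.comp (hf.sub continuous_const)
  -- The conjugate matches the conjugated coefficients in the hypothesis. Subtracting the mean `I`
  -- treats the trivial representations; coefficients of nontrivial irreducible ones have integral
  -- zero, so there the constant contributes nothing.
  have key := eq_zero_of_integral_mul_coeff_eq_zero (μ := μ) hc fun n σ hσ hσi v w => by
    have h1 : ∀ g, starRingEnd ℂ (f g - I) *
        ⟪v, (σ g : EuclideanSpace ℂ (Fin n) →L[ℂ] EuclideanSpace ℂ (Fin n)) w⟫_ℂ =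
        starRingEnd ℂ (f g * ⟪(σ g : EuclideanSpace ℂ (Fin n) →L[ℂ] _) w, v⟫_ℂ -
          I * ⟪(σ g : EuclideanSpace ℂ (Fin n) →L[ℂ] _) w, v⟫_ℂ) := fun g => by
      rw [← sub_mul, map_mul, inner_conj_symm]
    have hcv : Continuous fun g =>
      ⟪(σ g : EuclideanSpace ℂ (Fin n) →L[ℂ] EuclideanSpace ℂ (Fin n)) w, v⟫_ℂ :=
      (hσ w).inner continuous_const
    simp only [h1]
    rw [integral_conj, integral_sub (integrable_of_continuous (hf.fun_mul hcv))
      (integrable_of_continuous (continuous_const.fun_mul hcv)), integral_const_mul, map_eq_zero]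
    by_cases hne : ∃ g, σ g ≠ 1
    · rw [h n σ hσ hσi hne]
      have h2 : ∫ g, ⟪(σ g : EuclideanSpace ℂ (Fin n) →L[ℂ] _) w, v⟫_ℂ ∂μ =
          starRingEnd ℂ ⟪v, ∫ g, (σ g : EuclideanSpace ℂ (Fin n) →L[ℂ] _) w ∂μ⟫_ℂ := by
        rw [← integral_inner (integrable_of_continuous (hσ w)), ← integral_conj]
        simp only [inner_conj_symm]
      rw [h2, integral_eq_zero_of_nontrivial hσ hσi hne]
      simp
    · push Not at hne
      simp only [hne]
      simp [integral_mul_const, hI]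
  have := congrFun key g
  simp only [Pi.zero_apply, map_eq_zero] at this
  exact sub_eq_zero.1 this

end Averages

/-! ### Intertwiners on the fixed-point algebra: the vanishing lemma -/

section Intertwiners

variable {G : Type*} [Group G] [TopologicalSpace G] [IsTopologicalGroup G] [CompactSpace G]
  [MeasurableSpace G] [BorelSpace G] {μ : Measure G} [IsProbabilityMeasure μ] [μ.IsHaarMeasure]
  {H : Type*} [NormedAddCommGroup H] [InnerProductSpace ℂ H] [CompleteSpace H]
  {K : Type*} [NormedAddCommGroup K] [InnerProductSpace ℂ K] [CompleteSpace K]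
  {U : G →* unitary (H →L[ℂ] H)} {B : NonUnitalStarSubalgebra ℂ (H →L[ℂ] H)} {n : ℕ}
  {σ : G →* unitary (EuclideanSpace ℂ (Fin n) →L[ℂ] EuclideanSpace ℂ (Fin n))}
  {π : B →⋆ₙₐ[ℂ] (K →L[ℂ] K)} {T : EuclideanSpace ℂ (Fin n) →ₗ[ℂ] B} {S : H →L[ℂ] K}

/-- `S` intertwines the identical representation with `π` on the elements of `B` lying in `A`. -/
def IntertwinesOn (A : NonUnitalStarSubalgebra ℂ (H →L[ℂ] H)) (π : B →⋆ₙₐ[ℂ] (K →L[ℂ] K))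
    (S : H →L[ℂ] K) : Prop :=
  ∀ b : B, (b : H →L[ℂ] H) ∈ A → ∀ x, S ((b : H →L[ℂ] H) x) = π b (S x)

omit [CompleteSpace H] in
theorem inner_star_apply (A : H →L[ℂ] H) [CompleteSpace H] (x y : H) :
    ⟪x, A y⟫_ℂ = ⟪star A x, y⟫_ℂ := by
  rw [ContinuousLinearMap.star_eq_adjoint, ContinuousLinearMap.adjoint_inner_left]

omit [TopologicalSpace G] [IsTopologicalGroup G] [CompactSpace G] [MeasurableSpace G]
  [BorelSpace G] in
/-- Multiplets of a nontrivial irreducible representation map fixed vectors into the orthogonal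
complement of the fixed vectors. -/
theorem IsMultiplet.inner_eq_zero (hT : IsMultiplet U σ T)
    (hσi : ActsIrreducibly (Set.range fun g => (σ g : EuclideanSpace ℂ (Fin n) →L[ℂ] _)))
    (hne : ∃ g, σ g ≠ 1) {x y : H} (hx : IsFixedVector U x) (hy : IsFixedVector U y)
    (v : EuclideanSpace ℂ (Fin n)) : ⟪y, (T v : H →L[ℂ] H) x⟫_ℂ = 0 := by
  obtain ⟨g₀, hg₀⟩ := hne
  have hinv : ∀ g v, ⟪y, (T ((σ g : EuclideanSpace ℂ (Fin n) →L[ℂ] _) v) : H →L[ℂ] H) x⟫_ℂ =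
      ⟪y, (T v : H →L[ℂ] H) x⟫_ℂ := by
    intro g v
    rw [← hT.equivariant, conjBy_apply, hx, inner_unitaryRep_right, hy]
  -- The functional `v ↦ ⟪y, T v x⟫` is invariant under `σ`, so its kernel `M` is an invariant
  -- subspace containing every `σ(g) w - w`; `M = 0` would make `σ` trivial.
  set M : Submodule ℂ (EuclideanSpace ℂ (Fin n)) :=
    { carrier := {v | ⟪y, (T v : H →L[ℂ] H) x⟫_ℂ = 0}
      add_mem' := fun {a b} ha hb => by
        have : ⟪y, (T (a + b) : H →L[ℂ] H) x⟫_ℂ =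
          ⟪y, (T a : H →L[ℂ] H) x⟫_ℂ + ⟪y, (T b : H →L[ℂ] H) x⟫_ℂ := by
          rw [map_add, ← inner_add_right]; rfl
        rw [Set.mem_ofPred_eq, this, ha, hb, add_zero]
      zero_mem' := by rw [Set.mem_ofPred_eq, map_zero]; exact inner_zero_right _
      smul_mem' := fun c a ha => by
        have : ⟪y, (T (c • a) : H →L[ℂ] H) x⟫_ℂ = c * ⟪y, (T a : H →L[ℂ] H) x⟫_ℂ := by
          rw [map_smul, ← inner_smul_right]; rfl
        rw [Set.mem_ofPred_eq, this, ha, mul_zero] } with hM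
  rcases hσi.2 M M.closed_of_finiteDimensional (by
    rintro _ ⟨g, rfl⟩ w hw
    exact (hinv g w).trans hw) with h | h
  · refine absurd (Subtype.ext ?_) hg₀
    ext1 w
    have : (σ g₀ : EuclideanSpace ℂ (Fin n) →L[ℂ] _) w - w ∈ M := by
      change ⟪y, (T ((σ g₀ : EuclideanSpace ℂ (Fin n) →L[ℂ] _) w - w) : H →L[ℂ] H) x⟫_ℂ = 0
      have h2 : ⟪y, (T ((σ g₀ : EuclideanSpace ℂ (Fin n) →L[ℂ] _) w - w) : H →L[ℂ] H) x⟫_ℂ =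
          ⟪y, (T ((σ g₀ : EuclideanSpace ℂ (Fin n) →L[ℂ] _) w) : H →L[ℂ] H) x⟫_ℂ -
            ⟪y, (T w : H →L[ℂ] H) x⟫_ℂ := by
        rw [map_sub, ← inner_sub_right]; rfl
      rw [h2, hinv, sub_self]
    rw [h, Submodule.mem_bot] at this
    exact sub_eq_zero.1 this
  · have : v ∈ M := by rw [h]; trivial
    exact this

/-- The endomorphism `A ↦ ∑ ψᵢ A ψᵢ*` of `B` induced by a multiplet. -/
def multipletEndo (T : EuclideanSpace ℂ (Fin n) →ₗ[ℂ] B) (A : B) : B :=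
  multipletSum ((LinearMap.mulRight ℂ A).comp T) T

-- This exchange relation lets a fixed-point element `A` move past `T v` at the price of `ρ(A) = ∑
-- ψᵢ A ψᵢ*`, which is again a fixed point.
omit [TopologicalSpace G] [IsTopologicalGroup G] [CompactSpace G] [MeasurableSpace G]
  [BorelSpace G] in
theorem IsMultiplet.multipletEndo_mul (hT : IsMultiplet U σ T) (A : B)
    (v : EuclideanSpace ℂ (Fin n)) : multipletEndo T A * T v = T v * A :=
  hT.multipletSum_mul _ v

omit [TopologicalSpace G] [IsTopologicalGroup G] [CompactSpace G] [MeasurableSpace G]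
  [BorelSpace G] in
theorem IsMultiplet.multipletEndo_mem (hT : IsMultiplet U σ T) {A : B}
    (hA : (A : H →L[ℂ] H) ∈ fixedPointAlgebra U B) :
    (multipletEndo T A : H →L[ℂ] H) ∈ fixedPointAlgebra U B := by
  refine multipletSum_mem_fixedPointAlgebra (σ := σ) (fun g v => ?_) hT.equivariant
  change conjBy U g ((T v : H →L[ℂ] H) * A) = (T _ : H →L[ℂ] H) * A
  rw [conjBy_mul, hT.equivariant, hA.2 g]

-- On a fixed vector `α_g(b) x = U(g) b x`, so the averaging moves to the left-hand vector and the
-- functional remains of rank one in `b`.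
omit [μ.IsHaarMeasure] in
theorem inner_mean_apply_fixed (hB : IsClosed (B : Set (H →L[ℂ] H))) (hα : InducesAction U B)
    (hU : IsContinuousUnitaryRep U) {x : H} (hx : IsFixedVector U x) (u : H) (b : B) :
    ⟪u, (hα.mean μ b : H →L[ℂ] H) x⟫_ℂ =
      ⟪∫ g, (U g⁻¹ : H →L[ℂ] H) u ∂μ, (b : H →L[ℂ] H) x⟫_ℂ := by
  have hc : Continuous fun g => (U g⁻¹ : H →L[ℂ] H) u := (hU u).comp continuous_inv
  rw [InducesAction.mean, inner_coe_integral_apply hB (hα.continuous_act b), ← inner_conj_symm,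
    ← integral_inner (integrable_of_continuous hc), ← integral_conj]
  refine integral_congr_ae (Filter.Eventually.of_forall fun g => ?_)
  change ⟪u, conjBy U g b x⟫_ℂ = _
  rw [conjBy_apply, hx, inner_unitaryRep_right]
  exact (inner_conj_symm _ _).symm

/-- The spectral subspaces of nontrivial irreducible representations have vanishing matrix elements
between vectors `S y`, `S x`, where `x` and `y` are fixed vectors and `S` is an intertwiner on the
fixed-point algebra. -/
theorem IsMultiplet.inner_map_eq_zero (hT : IsMultiplet U σ T)
    (hB : IsClosed (B : Set (H →L[ℂ] H))) (hirr : ActsIrreducibly (B : Set (H →L[ℂ] H)))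
    (h1 : (1 : H →L[ℂ] H) ∈ B) (hU : IsContinuousUnitaryRep U) (hα : InducesAction U B)
    (μ : Measure G) [IsProbabilityMeasure μ] [μ.IsHaarMeasure] (hσ : IsContinuousUnitaryRep σ)
    (hσi : ActsIrreducibly (Set.range fun g => (σ g : EuclideanSpace ℂ (Fin n) →L[ℂ] _)))
    (hne : ∃ g, σ g ≠ 1) (hS : IntertwinesOn (fixedPointAlgebra U B) π S)
    {x y : H} (hx : IsFixedVector U x) (hy : IsFixedVector U y) (v : EuclideanSpace ℂ (Fin n)) :
    ⟪S y, π (T v) (S x)⟫_ℂ = 0 := by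
  rcases eq_or_ne x 0 with rfl | hx0
  · simp
  set e := EuclideanSpace.basisFun (Fin n) ℂ with he
  set R : H →L[ℂ] H := (ContinuousLinearMap.adjoint S) ∘L π (T v) ∘L S with hR
  have hRin : ∀ p q, ⟪p, R q⟫_ℂ = ⟪S p, π (T v) (S q)⟫_ℂ := fun p q =>
    ContinuousLinearMap.adjoint_inner_right S p _
  set z : Fin n → H := fun k => star (T (e k) : H →L[ℂ] H) (R x) with hz
  set p : Fin n → H := fun k => star (T (e k) : H →L[ℂ] H) y with hp
  -- This is `R A = ρ(A) R`, evaluated between `y` and `x` with `ρ(A)` expanded.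
  have hA : ∀ A : B, (A : H →L[ℂ] H) ∈ fixedPointAlgebra U B →
      ⟪star R y, (A : H →L[ℂ] H) x⟫_ℂ = ∑ k, ⟪p k, (A : H →L[ℂ] H) (z k)⟫_ℂ := by
    intro A hA
    have hρ := hT.multipletEndo_mem hA
    have hρ' : ((star (multipletEndo T A) : B) : H →L[ℂ] H) ∈ fixedPointAlgebra U B :=
      star_mem hρ
    rw [← inner_star_apply, hRin, hS A hA, ← mul_apply_eq_comp, ← map_mul, ← hT.multipletEndo_mul,
      map_mul, mul_apply_eq_comp, inner_star_apply, ← map_star, ← hS _ hρ', ← hRin]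
    change ⟪star (multipletEndo T A : H →L[ℂ] H) y, R x⟫_ℂ = _
    rw [← inner_star_apply, multipletEndo, coe_multipletSum, sum_apply,
      inner_sum]
    refine Finset.sum_congr rfl fun k _ => ?_
    change ⟪y, (T (e k) : H →L[ℂ] H) ((A : H →L[ℂ] H) (z k))⟫_ℂ = _
    rw [inner_star_apply]
  -- The translates of the `p k` stay in their finite span. This keeps the average of the right-hand
  -- side of `hA` a finite-rank functional of `b`.
  have hpU : ∀ g k, (U g⁻¹ : H →L[ℂ] H) (p k) = ∑ i, starRingEnd ℂ
      ⟪e i, (σ g⁻¹ : EuclideanSpace ℂ (Fin n) →L[ℂ] EuclideanSpace ℂ (Fin n)) (e k)⟫_ℂ • p i := by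
    intro g k
    have h2 : (U g⁻¹ : H →L[ℂ] H) (p k) =
        star (T ((σ g⁻¹ : EuclideanSpace ℂ (Fin n) →L[ℂ] _) (e k)) : H →L[ℂ] H) y := by
      rw [← hT.equivariant, ← conjBy_star, conjBy_apply, hy]
    rw [h2, ← sum_inner_smul_basis T, AddSubmonoidClass.coe_finsetSum, star_sum,
      sum_apply]
    refine Finset.sum_congr rfl fun i _ => ?_
    change star (⟪e i, _⟫_ℂ • (T (e i) : H →L[ℂ] H)) y = _
    rw [star_smul]
    rfl
  have hcc : ∀ i k, Continuous fun g =>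
      ⟪e i, (σ g⁻¹ : EuclideanSpace ℂ (Fin n) →L[ℂ] EuclideanSpace ℂ (Fin n)) (e k)⟫_ℂ •
        (U g⁻¹ : H →L[ℂ] H) (z k) := fun i k => by
    have h3 : Continuous fun g =>
      ⟪e i, (σ g⁻¹ : EuclideanSpace ℂ (Fin n) →L[ℂ] EuclideanSpace ℂ (Fin n)) (e k)⟫_ℂ :=
      continuous_const.inner ((hσ (e k)).comp continuous_inv)
    exact h3.fun_smul ((hU (z k)).comp continuous_inv)
  set w : Fin n → H := fun i => ∑ k, ∫ g,
    ⟪e i, (σ g⁻¹ : EuclideanSpace ℂ (Fin n) →L[ℂ] EuclideanSpace ℂ (Fin n)) (e k)⟫_ℂ •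
      (U g⁻¹ : H →L[ℂ] H) (z k) ∂μ with hw
  have hsum : ∀ b : B, ∑ k, ⟪p k, (hα.mean μ b : H →L[ℂ] H) (z k)⟫_ℂ =
      ∑ i, ⟪p i, (b : H →L[ℂ] H) (w i)⟫_ℂ := by
    intro b
    simp only [hw, map_sum, inner_sum]
    rw [Finset.sum_comm]
    refine Finset.sum_congr rfl fun k _ => ?_
    rw [InducesAction.mean, inner_coe_integral_apply hB (hα.continuous_act b)]
    have h4 : ∀ i, ⟪p i, (b : H →L[ℂ] H) (∫ g,
        ⟪e i, (σ g⁻¹ : EuclideanSpace ℂ (Fin n) →L[ℂ] EuclideanSpace ℂ (Fin n)) (e k)⟫_ℂ •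
          (U g⁻¹ : H →L[ℂ] H) (z k) ∂μ)⟫_ℂ = ∫ g,
        ⟪e i, (σ g⁻¹ : EuclideanSpace ℂ (Fin n) →L[ℂ] EuclideanSpace ℂ (Fin n)) (e k)⟫_ℂ *
          ⟪p i, (b : H →L[ℂ] H) ((U g⁻¹ : H →L[ℂ] H) (z k))⟫_ℂ ∂μ := by
      intro i
      rw [inner_star_apply, ← integral_inner (integrable_of_continuous (hcc i k))]
      simp only [inner_smul_right, ← inner_star_apply]
    simp only [h4]
    rw [← integral_finsetSum _ fun i _ => integrable_of_continuous ?_]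
    · refine integral_congr_ae (Filter.Eventually.of_forall fun g => ?_)
      change ⟪p k, conjBy U g b (z k)⟫_ℂ = _
      rw [conjBy_apply, inner_unitaryRep_right, hpU, sum_inner]
      simp only [inner_smul_left, Complex.conj_conj]
    · have h3 : Continuous fun g =>
        ⟪e i, (σ g⁻¹ : EuclideanSpace ℂ (Fin n) →L[ℂ] EuclideanSpace ℂ (Fin n)) (e k)⟫_ℂ :=
        continuous_const.inner ((hσ (e k)).comp continuous_inv)
      have h5 : Continuous fun g => (b : H →L[ℂ] H) ((U g⁻¹ : H →L[ℂ] H) (z k)) :=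
        (b : H →L[ℂ] H).continuous.comp ((hU (z k)).comp continuous_inv)
      exact h3.fun_mul (continuous_const.inner h5)
  set u₀ : H := ∫ g, (U g⁻¹ : H →L[ℂ] H) (star R y) ∂μ with hu₀
  -- The averaged identity `⟪u₀, b x⟫ = ∑ ⟪p i, b (w i)⟫` holds on `B`, hence for all bounded
  -- operators; the index `none` carries the `u₀` term. At the rank-one operator of `x` the
  -- right-hand side vanishes because each `p i` is orthogonal to `x`, leaving `⟪x, u₀⟫ = 0`.
  have hvan := sum_inner_eq_zero_of_irreducible hirr h1
    (fun o : Option (Fin n) => o.elim (-u₀) p) (fun o : Option (Fin n) => o.elim x w)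
    (fun b hb => by
      have h6 := hA (hα.mean μ ⟨b, hb⟩) (hα.mean_mem hB _)
      rw [hsum, inner_mean_apply_fixed hB hα hU hx] at h6
      rw [Fintype.sum_option]
      simp only [Option.elim_none, Option.elim_some, inner_neg_left]
      rw [← h6, ← hu₀, neg_add_cancel]) (InnerProductSpace.rankOne ℂ x x)
  rw [Fintype.sum_option] at hvan
  simp only [Option.elim_none, Option.elim_some, InnerProductSpace.rankOne_apply,
    inner_smul_right, inner_neg_left] at hvan
  have hpx : ∀ i, ⟪p i, x⟫_ℂ = 0 := fun i => by
    rw [hp, ← inner_star_apply]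
    exact hT.inner_eq_zero hσi hne hx hy _
  simp only [hpx, mul_zero, Finset.sum_const_zero, add_zero, mul_neg, neg_eq_zero, mul_eq_zero,
    inner_self_eq_zero, hx0, false_or] at hvan
  have hux : ⟪x, u₀⟫_ℂ = ⟪x, star R y⟫_ℂ := by
    have hc : Continuous fun g => (U g⁻¹ : H →L[ℂ] H) (star R y) := (hU _).comp continuous_inv
    rw [hu₀, ← integral_inner (integrable_of_continuous hc)]
    have hx' : ∀ g, (U g : H →L[ℂ] H) x = x := hx
    simp only [inner_unitaryRep_right, inv_inv, hx']
    simp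
  rw [← hRin, inner_star_apply, ← inner_conj_symm, ← hux, inner_conj_symm, hvan]

end Intertwiners

/-! ### Fixed vectors and the passage from `B^G` to `B` -/

section FixedVectors

variable {G : Type*} [Group G] [TopologicalSpace G] [IsTopologicalGroup G] [CompactSpace G]
  [MeasurableSpace G] [BorelSpace G] {μ : Measure G} [IsProbabilityMeasure μ] [μ.IsHaarMeasure]
  {H : Type*} [NormedAddCommGroup H] [InnerProductSpace ℂ H] [CompleteSpace H]
  {K : Type*} [NormedAddCommGroup K] [InnerProductSpace ℂ K] [CompleteSpace K]
  {U : G →* unitary (H →L[ℂ] H)} {B : NonUnitalStarSubalgebra ℂ (H →L[ℂ] H)} {n : ℕ}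
  {σ : G →* unitary (EuclideanSpace ℂ (Fin n) →L[ℂ] EuclideanSpace ℂ (Fin n))}
  {π : B →⋆ₙₐ[ℂ] (K →L[ℂ] K)} {T : EuclideanSpace ℂ (Fin n) →ₗ[ℂ] B} {S : H →L[ℂ] K}

theorem isFixedVector_integral (hU : IsContinuousUnitaryRep U) (x : H) :
    IsFixedVector U (∫ g, (U g : H →L[ℂ] H) x ∂μ) := by
  intro h
  rw [← ContinuousLinearMap.integral_comp_comm _ (integrable_of_continuous (hU x))]
  conv_rhs => rw [← integral_mul_left_eq_self _ h]
  simp only [unitaryRep_mul_apply]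

/-- Full Hilbert spectrum implies that there are nonzero fixed vectors. -/
theorem exists_isFixedVector_ne_zero (μ : Measure G) [IsProbabilityMeasure μ] [μ.IsHaarMeasure]
    [Nontrivial H] (hU : IsContinuousUnitaryRep U)
    (hfull : HasFullHilbertSpectrum U B) : ∃ x, IsFixedVector U x ∧ x ≠ 0 := by
  by_contra! hcon
  obtain ⟨x, hx⟩ := exists_ne (0 : H)
  have hf : Continuous fun g => ⟪x, (U g : H →L[ℂ] H) x⟫_ℂ := continuous_const.inner (hU x)
  -- The integral equals `⟪T v x, ∫ U(g) T w x dg⟫`, whose right entry is a fixed vector. Without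
  -- nonzero fixed vectors, Peter–Weyl forces `⟪x, U(g) x⟫ = 0` for all `g`, in particular at `g =
  -- 1`.
  have := eq_zero_of_integral_mul_coeff_eq_zero (μ := μ) hf fun n σ hσ hσi v w => by
    obtain ⟨T, hT⟩ := hfull.exists_isMultiplet hσ hσi
    have h1 := hcon _ (isFixedVector_integral (μ := μ) hU ((T w : H →L[ℂ] H) x))
    have h2 : ∀ g, (U g : H →L[ℂ] H) ((T w : H →L[ℂ] H) x) =
        (T ((σ g : EuclideanSpace ℂ (Fin n) →L[ℂ] EuclideanSpace ℂ (Fin n)) w) : H →L[ℂ] H)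
          ((U g : H →L[ℂ] H) x) := fun g => by
      rw [← hT.equivariant, conjBy_apply, ← unitaryRep_mul_apply, inv_mul_cancel,
        unitaryRep_one_apply]
    rw [← inner_zero_right ((T v : H →L[ℂ] H) x), ← h1, ← integral_inner
      (integrable_of_continuous (hU _))]
    refine integral_congr_ae (Filter.Eventually.of_forall fun g => ?_)
    simp only [h2]
    set a := (T ((σ g : EuclideanSpace ℂ (Fin n) →L[ℂ] EuclideanSpace ℂ (Fin n)) w) :
      H →L[ℂ] H) with ha
    rw [← star_star (T v : H →L[ℂ] H), ← inner_star_apply, ← mul_apply_eq_comp, ha, hT.star_mul,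
      smul_apply, one_apply_eq_self, inner_smul_right, mul_comm]
  have h1 := congrFun this 1
  simp only [unitaryRep_one_apply, Pi.zero_apply, inner_self_eq_zero] at h1
  exact hx h1

omit [IsTopologicalGroup G] [μ.IsHaarMeasure] in
theorem integral_inner_map_act_mul_coeff (hB : IsClosed (B : Set (H →L[ℂ] H)))
    (hα : InducesAction U B) (hσ : IsContinuousUnitaryRep σ) (π : B →⋆ₙₐ[ℂ] (K →L[ℂ] K))
    (p q : K) (c : B) (v w : EuclideanSpace ℂ (Fin n)) :
    ∫ g, ⟪p, π (hα.act g c) q⟫_ℂ *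
        ⟪(σ g : EuclideanSpace ℂ (Fin n) →L[ℂ] EuclideanSpace ℂ (Fin n)) w, v⟫_ℂ ∂μ =
      ⟪p, π (spectralComponent μ hα hσ w c v) q⟫_ℂ := by
  change _ = ⟪p, π (∫ g, _ ∂μ) q⟫_ℂ
  rw [inner_map_integral_apply hB π (hα.continuous_coeff_smul_act hσ w v c)]
  refine integral_congr_ae (Filter.Eventually.of_forall fun g => ?_)
  simp only [map_smul, smul_apply, inner_smul_right]
  ring

omit [IsTopologicalGroup G] [CompactSpace G] [MeasurableSpace G] [BorelSpace G] in
theorem continuous_inner_map_act (hB : IsClosed (B : Set (H →L[ℂ] H))) (hα : InducesAction U B)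
    (π : B →⋆ₙₐ[ℂ] (K →L[ℂ] K)) (p q : K) (c : B) :
    Continuous fun g => ⟪p, π (hα.act g c) q⟫_ℂ :=
  continuous_const.inner
    (((representationCLM hB π).continuous.comp (hα.continuous_act c)).clm_apply continuous_const)

omit [IsTopologicalGroup G] [μ.IsHaarMeasure] in
theorem inner_map_mean_apply (hB : IsClosed (B : Set (H →L[ℂ] H))) (hα : InducesAction U B)
    (π : B →⋆ₙₐ[ℂ] (K →L[ℂ] K)) (p q : K) (c : B) :
    ⟪p, π (hα.mean μ c) q⟫_ℂ = ∫ g, ⟪p, π (hα.act g c) q⟫_ℂ ∂μ :=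
  inner_map_integral_apply hB π (hα.continuous_act c) p q

omit [IsTopologicalGroup G] [μ.IsHaarMeasure] in
theorem mean_star_mul_self_nonneg (hB : IsClosed (B : Set (H →L[ℂ] H))) (hα : InducesAction U B)
    (b : B) : 0 ≤ (hα.mean μ (star b * b) : H →L[ℂ] H) := by
  rw [InducesAction.mean, coe_integral hB (hα.continuous_act _)]
  refine (convex_Ici (𝕜 := ℝ) (0 : H →L[ℂ] H)).integral_mem isClosed_Ici
    (Filter.Eventually.of_forall fun g => ?_)
    (integrable_of_continuous (continuous_subtype_val.comp (hα.continuous_act _)))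
  change 0 ≤ conjBy U g (star (b : H →L[ℂ] H) * b)
  rw [conjBy_mul, conjBy_star]
  exact star_mul_self_nonneg _

/-- For an intertwiner `S` on the fixed-point algebra and a fixed vector `x`, the vector `S x` is
dominated by `x` on the whole algebra. -/
theorem IntertwinesOn.exists_norm_map_apply_le (hS : IntertwinesOn (fixedPointAlgebra U B) π S)
    (hB : IsClosed (B : Set (H →L[ℂ] H))) (hirr : ActsIrreducibly (B : Set (H →L[ℂ] H)))
    (hU : IsContinuousUnitaryRep U) (hα : InducesAction U B) (hfull : HasFullHilbertSpectrum U B)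
    (μ : Measure G) [IsProbabilityMeasure μ] [μ.IsHaarMeasure] {x : H} (hx : IsFixedVector U x) :
    ∃ C : ℝ, ∀ b : B, ‖π b (S x)‖ ≤ C * ‖(b : H →L[ℂ] H) x‖ := by
  set Q : H →L[ℂ] H := (ContinuousLinearMap.adjoint S) ∘L S with hQ
  refine ⟨√‖Q‖, fun b => ?_⟩
  set c : B := star b * b with hc
  set A : H →L[ℂ] H := (hα.mean μ c : H →L[ℂ] H) with hA
  have hAfix : A ∈ fixedPointAlgebra U B := hα.mean_mem hB c
  -- A nontrivial component is `D ψ` with `D` fixed. Moving `D` to the left as `S (D* x)`, with `D*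
  -- x` again a fixed vector, reduces to the vanishing lemma. The value at `1` is therefore the
  -- mean: `‖π b (S x)‖² = ⟪x, Q A x⟫`.
  have hconst := eq_integral_of_coeff_eq_zero (μ := μ)
    (continuous_inner_map_act hB hα π (S x) (S x) c) (fun n σ hσ hσi hne v w => by
      obtain ⟨T, hT⟩ := hfull.exists_isMultiplet hσ hσi
      obtain ⟨D, hD, hDT⟩ := spectralComponent_eq_mul (μ := μ) hT hB hα hσ w c
      rw [integral_inner_map_act_mul_coeff hB hα hσ, hDT, map_mul, mul_apply_eq_comp,
        inner_star_apply, ← map_star,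
        ← hS (star D) (star_mem (S := NonUnitalStarSubalgebra ℂ (H →L[ℂ] H)) hD)]
      exact hT.inner_map_eq_zero hB hirr hfull.one_mem hU hα μ hσ hσi hne hS hx
        (hx.apply_of_conjBy_eq (star_mem (S := NonUnitalStarSubalgebra ℂ (H →L[ℂ] H)) hD).2) v) 1
  rw [hα.act_one, ← inner_map_mean_apply hB hα, ← hS _ hAfix, hc, map_mul, mul_apply_eq_comp,
    inner_star_apply, map_star, star_star] at hconst
  have hcomm : Commute Q A := by
    have hA' : star A ∈ fixedPointAlgebra U B := star_mem hAfix
    ext1 y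
    refine ext_inner_left ℂ fun z => ?_
    change ⟪z, (ContinuousLinearMap.adjoint S) (S (A y))⟫_ℂ =
      ⟪z, A ((ContinuousLinearMap.adjoint S) (S y))⟫_ℂ
    rw [ContinuousLinearMap.adjoint_inner_right, hS (hα.mean μ c) hAfix, inner_star_apply,
      inner_star_apply A, ContinuousLinearMap.adjoint_inner_right, ← map_star]
    congr 1
    exact (hS (star (hα.mean μ c)) hA' z).symm
  have hQsa : IsSelfAdjoint Q := (ContinuousLinearMap.isPositive_adjoint_comp_self S).isSelfAdjoint
  -- `Q = S* S` commutes with the fixed point `A`, so `Q A ≤ ‖Q‖ A`. For fixed `x`, moreover, `⟪x, A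
  -- x⟫ = ‖b x‖²`.
  have hpos : 0 ≤ (algebraMap ℝ (H →L[ℂ] H) ‖Q‖ - Q) * A :=
    Commute.mul_nonneg (sub_nonneg.2 hQsa.le_algebraMap_norm_self)
      (mean_star_mul_self_nonneg hB hα b)
      (Commute.sub_left (Algebra.commutes ‖Q‖ A) hcomm)
  have h1 := ((ContinuousLinearMap.nonneg_iff_isPositive _).1 hpos).re_inner_nonneg_right x
  have h2 : ⟪x, A x⟫_ℂ = ((‖(b : H →L[ℂ] H) x‖ ^ 2 : ℝ) : ℂ) := by
    have hx' : ∀ g, (U g : H →L[ℂ] H) x = x := hx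
    rw [hA, inner_mean_apply_fixed hB hα hU hx]
    simp only [hx', integral_const, probReal_univ, one_smul]
    change ⟪x, star (b : H →L[ℂ] H) ((b : H →L[ℂ] H) x)⟫_ℂ = _
    rw [inner_star_apply, star_star, inner_self_eq_norm_sq_to_K]
    push_cast; rfl
  have h3 : ⟪x, ((algebraMap ℝ (H →L[ℂ] H) ‖Q‖ - Q) * A) x⟫_ℂ =
      ((‖Q‖ * ‖(b : H →L[ℂ] H) x‖ ^ 2 - ‖π b (S x)‖ ^ 2 : ℝ) : ℂ) := by
    have h4 : ⟪x, Q (A x)⟫_ℂ = ((‖π b (S x)‖ ^ 2 : ℝ) : ℂ) := by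
      change ⟪x, (ContinuousLinearMap.adjoint S) (S (A x))⟫_ℂ = _
      rw [ContinuousLinearMap.adjoint_inner_right]
      refine hconst.symm.trans ?_
      rw [inner_self_eq_norm_sq_to_K]
      push_cast; rfl
    rw [mul_apply_eq_comp, sub_apply, inner_sub_right, h4, Algebra.algebraMap_eq_smul_one,
      smul_apply, one_apply_eq_self, ← Complex.coe_smul, inner_smul_right, h2]
    push_cast; rfl
  rw [h3] at h1
  have h5 : ‖π b (S x)‖ ^ 2 ≤ ‖Q‖ * ‖(b : H →L[ℂ] H) x‖ ^ 2 := by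
    have : (0 : ℝ) ≤ ‖Q‖ * ‖(b : H →L[ℂ] H) x‖ ^ 2 - ‖π b (S x)‖ ^ 2 := h1
    linarith
  refine (pow_le_pow_iff_left₀ (norm_nonneg _) (by positivity) two_ne_zero).1 ?_
  rw [mul_pow, Real.sq_sqrt (norm_nonneg _)]
  exact h5

/-- If `Q` commutes with `π` and annihilates the intertwiners on `B`, then it annihilates the
intertwiners on the fixed-point algebra. -/
theorem comp_eq_zero_of_intertwinesOn (hB : IsClosed (B : Set (H →L[ℂ] H)))
    (hirr : ActsIrreducibly (B : Set (H →L[ℂ] H)))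
    (hU : IsContinuousUnitaryRep U) (hα : InducesAction U B) (hfull : HasFullHilbertSpectrum U B)
    (μ : Measure G) [IsProbabilityMeasure μ] [μ.IsHaarMeasure] {Q : K →L[ℂ] K}
    (hQ : ∀ b y, Q (π b y) = π b (Q y)) (hW : ∀ W, IntertwinesOn B π W → ∀ x, Q (W x) = 0)
    (hS : IntertwinesOn (fixedPointAlgebra U B) π S) (x : H) : Q (S x) = 0 := by
  have h1B := hfull.one_mem
  have hfix : ∀ S : H →L[ℂ] K, IntertwinesOn (fixedPointAlgebra U B) π S →
      ∀ x, IsFixedVector U x → Q (S x) = 0 := by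
    intro S hS x hx
    obtain ⟨C, hC⟩ := hS.exists_norm_map_apply_le hB hirr hU hα hfull μ hx
    have h1fix : ((⟨1, h1B⟩ : B) : H →L[ℂ] H) ∈ fixedPointAlgebra U B := ⟨h1B, conjBy_one⟩
    obtain ⟨V, hV, hVx⟩ := exists_intertwiner_of_norm_le
      (NonUnitalStarSubalgebraClass.subtype B) π x (S x) C hC
      ⟨⟨1, h1B⟩, rfl, by rw [← hS _ h1fix]; rfl⟩
    rw [← hVx]
    exact hW V (fun b _ ξ => hV b ξ) x
  have hmul : ∀ (n : ℕ) (σ : G →* unitary (EuclideanSpace ℂ (Fin n) →L[ℂ] _))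
      (T : EuclideanSpace ℂ (Fin n) →ₗ[ℂ] B), IsMultiplet U σ T → ∀ v x, IsFixedVector U x →
      Q (S ((T v : H →L[ℂ] H) x)) = 0 := by
    intro n σ T hT v x hx
    set o : B := ⟨1, h1B⟩ with ho
    have ho1 : ∀ b : B, b * o = b := fun b => Subtype.ext (mul_one _)
    have hofix : (o : H →L[ℂ] H) ∈ fixedPointAlgebra U B := ⟨h1B, conjBy_one⟩
    have hT1 : multipletEndo T o * T v = T v := by rw [hT.multipletEndo_mul, ho1]
    have h2 : S ((T v : H →L[ℂ] H) x) = π (multipletEndo T o) (S ((T v : H →L[ℂ] H) x)) := by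
      rw [← hS _ (hT.multipletEndo_mem hofix), ← mul_apply_eq_comp]
      congr 2
      exact congrArg Subtype.val hT1.symm
    have h3 : ∀ k, Q (π (star (T (EuclideanSpace.basisFun (Fin n) ℂ k)))
        (S ((T v : H →L[ℂ] H) x))) = 0 := by
      intro k
      set a := T (EuclideanSpace.basisFun (Fin n) ℂ k) with ha
      -- The operator `π(ψₖ*) S ψ` intertwines on `B^G` again: `ψ A = ρ(A) ψ` and `ψₖ* ρ(A) = A
      -- ψₖ*`. Since `S ψ x = ∑ π(ψₖ) π(ψₖ*) S ψ x`, the case of fixed vectors suffices.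
      refine hfix (π (star a) ∘L S ∘L (T v : H →L[ℂ] H)) (fun A hA y => ?_) x hx
      have h4 : (T v : H →L[ℂ] H) ((A : H →L[ℂ] H) y) =
          (multipletEndo T A : H →L[ℂ] H) ((T v : H →L[ℂ] H) y) :=
        DFunLike.congr_fun (congrArg Subtype.val (hT.multipletEndo_mul A v).symm) y
      have h5 : star a * multipletEndo T A = A * star a := by
        have := congrArg star (hT.multipletEndo_mul (star A) (EuclideanSpace.basisFun (Fin n) ℂ k))
        have h6 : star (multipletEndo T (star A)) = multipletEndo T A := by
          simp [multipletEndo, multipletSum, star_sum, mul_assoc]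
        rwa [star_mul, star_mul, h6, star_star, ← ha] at this
      simp only [ContinuousLinearMap.comp_apply]
      rw [h4, hS _ (hT.multipletEndo_mem hA), ← mul_apply_eq_comp, ← map_mul, h5, map_mul]
      rfl
    rw [h2, multipletEndo, multipletSum, map_sum, sum_apply, map_sum]
    refine Finset.sum_eq_zero fun k _ => ?_
    rw [map_mul, mul_apply_eq_comp, hQ, h3, map_zero]
  have hBx : ∀ x, IsFixedVector U x → ∀ c : B, Q (S ((c : H →L[ℂ] H) x)) = 0 := by
    intro x hx c
    refine ext_inner_left ℂ fun p => ?_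
    set p' : H := ContinuousLinearMap.adjoint (Q ∘L S) p with hp'
    have hp : ∀ y, ⟪p', y⟫_ℂ = ⟪p, Q (S y)⟫_ℂ := fun y =>
      ContinuousLinearMap.adjoint_inner_left (Q ∘L S) y p
    set ι := NonUnitalStarSubalgebraClass.subtype B with hι
    -- Nontrivial components are `D ψ` with `D` fixed, and `Q S D ψ x = π(D) Q S ψ x = 0`. Only the
    -- mean of `c` is left, and it maps `x` to a fixed vector.
    have hconst := eq_integral_of_coeff_eq_zero (μ := μ)
      (continuous_inner_map_act hB hα ι p' x c) (fun n σ hσ hσi hne v w => by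
        obtain ⟨T, hT⟩ := hfull.exists_isMultiplet hσ hσi
        obtain ⟨D, hD, hDT⟩ := spectralComponent_eq_mul (μ := μ) hT hB hα hσ w c
        rw [integral_inner_map_act_mul_coeff hB hα hσ, hDT, hp]
        change ⟪p, Q (S ((D : H →L[ℂ] H) ((T v : H →L[ℂ] H) x)))⟫_ℂ = 0
        rw [hS D hD, hQ, hmul n σ T hT v x hx, map_zero, inner_zero_right]) 1
    rw [hα.act_one, ← inner_map_mean_apply hB hα, hp, hp] at hconst
    refine hconst.trans ?_
    rw [inner_zero_right]
    change ⟪p, Q (S ((hα.mean μ c : H →L[ℂ] H) x))⟫_ℂ = 0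
    rw [hfix S hS _ (hx.apply_of_conjBy_eq (hα.mean_mem hB c).2), inner_zero_right]
  have := hirr.1
  obtain ⟨x₀, hx₀, hx₀0⟩ := exists_isFixedVector_ne_zero μ hU hfull
  set M : Submodule ℂ H := ⨅ c : B, LinearMap.ker (Q ∘L S ∘L (c : H →L[ℂ] H)).toLinearMap with hM
  have hMmem : ∀ y, y ∈ M ↔ ∀ c : B, Q (S ((c : H →L[ℂ] H) y)) = 0 := fun y => by
    rw [hM, Submodule.mem_iInf]; rfl
  rcases hirr.2 M (by
    rw [hM, Submodule.coe_iInf]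
    exact isClosed_iInter fun c => (Q ∘L S ∘L (c : H →L[ℂ] H)).isClosed_ker)
    (fun b hb y hy => (hMmem _).2 fun c => (hMmem y).1 hy (c * (⟨b, hb⟩ : B))) with h | h
  · have : x₀ ∈ M := (hMmem _).2 (hBx x₀ hx₀)
    rw [h, Submodule.mem_bot] at this
    exact absurd this hx₀0
  · have : x ∈ M := by rw [h]; trivial
    exact (hMmem x).1 this ⟨1, h1B⟩

end FixedVectors

/-! ### Consequences of normality on a subalgebra -/

section Normality

variable {H : Type*} [NormedAddCommGroup H] [InnerProductSpace ℂ H] [CompleteSpace H]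
  {K : Type*} [NormedAddCommGroup K] [InnerProductSpace ℂ K] [CompleteSpace K]
  {A B : NonUnitalStarSubalgebra ℂ (H →L[ℂ] H)} {π : B →⋆ₙₐ[ℂ] (K →L[ℂ] K)}

/-- The ultraweakly continuous functional `a ↦ ∑ₙ ⟪xₙ, a yₙ⟫` on an operator algebra. -/
def ultraweakFunctional (A : NonUnitalStarSubalgebra ℂ (H →L[ℂ] H)) (x y : lp (fun _ : ℕ => H) 2) :
    A →ₗ[ℂ] ℂ where
  toFun a := ⟪x, amp H ℕ (a : H →L[ℂ] H) y⟫_ℂ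
  map_add' a b := by
    rw [← inner_add_right]; rw [NonUnitalStarSubalgebra.coe_add, map_add]; rfl
  map_smul' c a := by
    rw [NonUnitalStarSubalgebra.coe_smul, map_smul, smul_apply, inner_smul_right]; rfl

theorem ultraweakFunctional_apply (x y : lp (fun _ : ℕ => H) 2) (a : A) :
    ultraweakFunctional A x y a = ⟪x, amp H ℕ (a : H →L[ℂ] H) y⟫_ℂ := rfl

theorem ultraweakFunctional_apply_eq_tsum (x y : lp (fun _ : ℕ => H) 2) (a : A) :
    ultraweakFunctional A x y a = ∑' n, ⟪x n, (a : H →L[ℂ] H) (y n)⟫_ℂ :=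
  lp.inner_eq_tsum _ _

theorem continuous_inner_amp (x y : lp (fun _ : ℕ => K) 2) :
    @Continuous _ _ (ultraweakTopology K) _ fun T : K →L[ℂ] K => ⟪x, amp K ℕ T y⟫_ℂ := by
  simp only [lp.inner_eq_tsum, amp_apply]
  exact continuous_iff_le_induced.2 (iInf₂_le (f := fun (x : lp (fun _ : ℕ => K) 2)
    (y : lp (fun _ : ℕ => K) 2) => TopologicalSpace.induced
      (fun T : K →L[ℂ] K => ∑' n, ⟪x n, T (y n)⟫_ℂ) inferInstance) x y)

/-- The functionals `a ↦ ∑ₙ ⟪xₙ, π a yₙ⟫` of a representation normal on `A` are ultraweakly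
continuous on `A`. -/
theorem IsNormalOn.exists_mem_span_ultraweakFunctional (hπ : IsNormalOn π A) (hAB : A ≤ B)
    (x y : lp (fun _ : ℕ => K) 2) :
    ∃ φ ∈ Submodule.span ℂ (Set.range fun p : lp (fun _ : ℕ => H) 2 × lp (fun _ : ℕ => H) 2 =>
      ultraweakFunctional A p.1 p.2), ∀ a : A,
      φ a = ⟪x, amp K ℕ (π (NonUnitalStarSubalgebra.inclusion hAB a)) y⟫_ℂ := by
  refine ⟨
    { toFun := fun a => ⟪x, amp K ℕ (π (NonUnitalStarSubalgebra.inclusion hAB a)) y⟫_ℂ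
      map_add' := fun a b => by rw [← inner_add_right, map_add, map_add, map_add]; rfl
      map_smul' := fun c a => by
        rw [map_smul, map_smul, map_smul, smul_apply, inner_smul_right]; rfl }, ?_, fun a => rfl⟩
  -- A linear functional continuous for the initial topology of a family of functionals is a finite
  -- linear combination of them.
  rw [LinearMap.mem_span_iff_continuous]
  let τ : TopologicalSpace A := ⨅ p : lp (fun _ : ℕ => H) 2 × lp (fun _ : ℕ => H) 2,
    TopologicalSpace.induced (ultraweakFunctional A p.1 p.2) inferInstance
  have h2 : @Continuous _ _ τ (TopologicalSpace.induced
      (fun b : {b : B // (b : H →L[ℂ] H) ∈ A} => ((b : B) : H →L[ℂ] H)) (ultraweakTopology H))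
      fun a : A => ⟨NonUnitalStarSubalgebra.inclusion hAB a, a.2⟩ := by
    refine continuous_induced_rng.2 (continuous_iInf_rng.2 fun ξ => continuous_iInf_rng.2 fun η =>
      continuous_induced_rng.2 ?_)
    have : @Continuous _ _ τ _ (ultraweakFunctional A ξ η) :=
      continuous_iff_le_induced.2 (iInf_le _ (ξ, η))
    exact this.congr fun a => ultraweakFunctional_apply_eq_tsum ξ η a
  exact @Continuous.comp _ _ _ τ (ultraweakTopology K) _ _ _ (continuous_inner_amp x y)
    (@Continuous.comp _ _ _ τ (TopologicalSpace.induced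
      (fun b : {b : B // (b : H →L[ℂ] H) ∈ A} => ((b : B) : H →L[ℂ] H)) (ultraweakTopology H))
      (ultraweakTopology K) _ _ hπ h2)

/-- At `a* a` the functional becomes `‖π(a) y‖²` on one side and `∑ c_p ⟪a p.1, a p.2⟫` on the
other; Cauchy–Schwarz bounds it by the finitely many vectors involved. -/
theorem norm_sq_le_of_mem_span_ultraweakFunctional (hAB : A ≤ B) {y : K} {φ : A →ₗ[ℂ] ℂ}
    (hφ : φ ∈ Submodule.span ℂ (Set.range fun p : lp (fun _ : ℕ => H) 2 × lp (fun _ : ℕ => H) 2 =>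
      ultraweakFunctional A p.1 p.2))
    (hφy : ∀ a : A, φ a = ⟪y, π (NonUnitalStarSubalgebra.inclusion hAB a) y⟫_ℂ) :
    ∃ (s : Finset (lp (fun _ : ℕ => H) 2 × lp (fun _ : ℕ => H) 2)) (C : ℝ),
      0 ≤ C ∧ ∀ (a : A) (M : ℝ), (∀ p ∈ s, ‖amp H ℕ (a : H →L[ℂ] H) p.1‖ ≤ M ∧
        ‖amp H ℕ (a : H →L[ℂ] H) p.2‖ ≤ M) →
      ‖π (NonUnitalStarSubalgebra.inclusion hAB a) y‖ ^ 2 ≤ C * M ^ 2 := by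
  obtain ⟨c, rfl⟩ := Finsupp.mem_span_range_iff_exists_finsupp.1 hφ
  refine ⟨c.support, ∑ p ∈ c.support, ‖c p‖, by positivity, fun a M hM => ?_⟩
  set a' := NonUnitalStarSubalgebra.inclusion hAB a with ha'
  have h1 : ⟪π a' y, π a' y⟫_ℂ = ∑ p ∈ c.support, c p *
      ⟪amp H ℕ (a : H →L[ℂ] H) p.1, amp H ℕ (a : H →L[ℂ] H) p.2⟫_ℂ := by
    have h2 := hφy (star a * a)
    rw [map_mul (NonUnitalStarSubalgebra.inclusion hAB),
      map_star (NonUnitalStarSubalgebra.inclusion hAB), map_mul π, map_star π, mul_apply_eq_comp,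
      inner_star_apply _ y, star_star] at h2
    rw [← h2, Finsupp.sum, LinearMap.sum_apply]
    refine Finset.sum_congr rfl fun p _ => ?_
    have h3 : ((star a * a : A) : H →L[ℂ] H) = star (a : H →L[ℂ] H) * a := rfl
    rw [LinearMap.smul_apply, smul_eq_mul, ultraweakFunctional_apply, h3, map_mul, map_star,
      mul_apply_eq_comp, inner_star_apply _ p.1, star_star]
  calc ‖π a' y‖ ^ 2 = ‖⟪π a' y, π a' y⟫_ℂ‖ := by
        rw [inner_self_eq_norm_sq_to_K, norm_pow]; simp
    _ ≤ ∑ p ∈ c.support, ‖c p‖ * M ^ 2 := by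
        rw [h1]
        refine (norm_sum_le _ _).trans (Finset.sum_le_sum fun p hp => ?_)
        rw [norm_mul]
        gcongr
        refine (norm_inner_le_norm _ _).trans ?_
        obtain ⟨h2, h3⟩ := hM p hp
        rw [sq]
        exact mul_le_mul h2 h3 (norm_nonneg _) ((norm_nonneg _).trans h2)
    _ = _ := by rw [Finset.sum_mul]

theorem norm_apply_le_norm_amp {ι : Type*} (T : H →L[ℂ] H) (x : lp (fun _ : ι => H) 2) (i : ι) :
    ‖T (x i)‖ ≤ ‖amp H ι T x‖ := by
  rw [← amp_apply]
  exact lp.norm_apply_le_norm two_ne_zero _ i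

/-- Restricting `V` to each copy of `H` in the double sum gives an intertwiner from `H`; these
copies span a dense subspace. -/
theorem comp_eq_zero_of_comp_amp {ι : Type*} (hAB : A ≤ B)
    {V : lp (fun _ : ι => lp (fun _ : ℕ => H) 2) 2 →L[ℂ] K}
    (hV : ∀ (a : A) ξ, V (amp (lp (fun _ : ℕ => H) 2) ι (amp H ℕ (a : H →L[ℂ] H)) ξ) =
      π (NonUnitalStarSubalgebra.inclusion hAB a) (V ξ))
    {Q : K →L[ℂ] K} (hQ : ∀ S, IntertwinesOn A π S → ∀ x, Q (S x) = 0) : Q ∘L V = 0 := by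
  classical
  refine eq_of_comp_single fun p x => ?_
  set Vp := V ∘L lp.singleContinuousLinearMap ℂ (fun _ : ι => lp (fun _ : ℕ => H) 2) 2 p with hVp
  have : Q ∘L Vp = 0 := by
    refine eq_of_comp_single fun n x => ?_
    refine hQ (Vp ∘L lp.singleContinuousLinearMap ℂ (fun _ : ℕ => H) 2 n) (fun b hb x => ?_) x
    change V (lp.single 2 p (lp.single 2 n ((b : H →L[ℂ] H) x))) =
      π b (V (lp.single 2 p (lp.single 2 n x)))
    rw [← amp_single, ← amp_single]
    exact hV ⟨b, hb⟩ _
  exact DFunLike.congr_fun this x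

/-- A vector dominated by finitely many vectors of another representation is in the range of an
intertwiner from a multiple of that representation. -/
theorem exists_intertwiner_of_norm_sq_le {A D ι : Type*} [NonUnitalRing A] [StarRing A] [Module ℂ A]
    [NormedAddCommGroup D] [InnerProductSpace ℂ D] [CompleteSpace D] [Finite ι]
    (θ : A →⋆ₙₐ[ℂ] (D →L[ℂ] D)) (ρ : A →⋆ₙₐ[ℂ] (K →L[ℂ] K)) (ζ : ι → D) (y : K) {C : ℝ}
    (hC : 0 ≤ C) (h : ∀ a M, (∀ i, ‖θ a (ζ i)‖ ≤ M) → ‖ρ a y‖ ^ 2 ≤ C * M ^ 2)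
    (h1 : ∃ e, (∀ i, θ e (ζ i) = ζ i) ∧ ρ e y = y) :
    ∃ V : lp (fun _ : ι => D) 2 →L[ℂ] K, (∀ a ξ, V (amp D ι (θ a) ξ) = ρ a (V ξ)) ∧
      ∃ ξ, V ξ = y := by
  obtain ⟨e, he, he'⟩ := h1
  -- Collecting the `ζ i` in one vector of the multiple reduces to domination by a single vector,
  -- since the norm of each component is at most the norm of the whole.
  set ξ : lp (fun _ : ι => D) 2 := ⟨ζ, Memℓp.all ζ⟩ with hξ
  obtain ⟨V, hV, hVξ⟩ := exists_intertwiner_of_norm_le ((amp D ι).comp θ) ρ ξ y (√C) (fun a => by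
    refine (pow_le_pow_iff_left₀ (norm_nonneg _) (by positivity) two_ne_zero).1 ?_
    rw [mul_pow, Real.sq_sqrt hC]
    exact h a _ fun i => norm_apply_le_norm_amp (θ a) ξ i) ⟨e, by ext i; exact he i, he'⟩
  exact ⟨V, hV, ξ, hVξ⟩

/-- An operator annihilating the ranges of the intertwiners on `A` annihilates every vector which
defines an ultraweakly continuous functional on `A`. -/
theorem map_eq_zero_of_mem_span_ultraweakFunctional (hAB : A ≤ B) (h1A : (1 : H →L[ℂ] H) ∈ A)
    {y : K} (hy : π ⟨1, hAB h1A⟩ y = y) {φ : A →ₗ[ℂ] ℂ}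
    (hφ : φ ∈ Submodule.span ℂ (Set.range fun p : lp (fun _ : ℕ => H) 2 × lp (fun _ : ℕ => H) 2 =>
      ultraweakFunctional A p.1 p.2))
    (hφy : ∀ a : A, φ a = ⟪y, π (NonUnitalStarSubalgebra.inclusion hAB a) y⟫_ℂ)
    {Q : K →L[ℂ] K} (hQ : ∀ S, IntertwinesOn A π S → ∀ x, Q (S x) = 0) : Q y = 0 := by
  obtain ⟨s, C, hC, hs⟩ := norm_sq_le_of_mem_span_ultraweakFunctional hAB hφ hφy
  -- The two summands of `s ⊕ s` carry the left and the right vectors of the pairs in `s`.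
  obtain ⟨V, hV, ξ, rfl⟩ := exists_intertwiner_of_norm_sq_le (ι := s ⊕ s)
    ((amp H ℕ).comp (NonUnitalStarSubalgebraClass.subtype A))
    (π.comp (NonUnitalStarSubalgebra.inclusion hAB)) (Sum.elim (fun p => p.1.1) (fun p => p.1.2)) y
    hC (fun a M h => hs a M fun p hp => ⟨h (Sum.inl ⟨p, hp⟩), h (Sum.inr ⟨p, hp⟩)⟩)
    ⟨⟨1, h1A⟩, fun i => by ext; rfl, hy⟩
  exact DFunLike.congr_fun (comp_eq_zero_of_comp_amp hAB hV hQ) ξ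

end Normality

/-! ### The part of `π` that is a multiple of the identical representation -/

section Decomposition

variable {H : Type*} [NormedAddCommGroup H] [InnerProductSpace ℂ H] [CompleteSpace H]
  {K : Type u} [NormedAddCommGroup K] [InnerProductSpace ℂ K] [CompleteSpace K]
  {B : NonUnitalStarSubalgebra ℂ (H →L[ℂ] H)} {π : B →⋆ₙₐ[ℂ] (K →L[ℂ] K)} {W W' : H →L[ℂ] K}

theorem inner_map_star_apply (b : B) (x y : K) : ⟪π b x, y⟫_ℂ = ⟪x, π (star b) y⟫_ℂ := by
  rw [inner_star_apply _ x, map_star, star_star]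

/-- `W* W'` commutes with `B`, hence is scalar. Intertwiners are therefore determined by their value
at a unit vector, which turns them into a Hilbert space. -/
theorem IntertwinesOn.exists_inner_eq (hirr : ActsIrreducibly (B : Set (H →L[ℂ] H)))
    (hW : IntertwinesOn B π W) (hW' : IntertwinesOn B π W') :
    ∃ c : ℂ, ∀ x y, ⟪W x, W' y⟫_ℂ = c * ⟪x, y⟫_ℂ := by
  obtain ⟨c, hc⟩ := exists_eq_smul_one_of_commute hirr
    (T := ContinuousLinearMap.adjoint W ∘L W') fun b hb => by
      ext y
      refine ext_inner_left ℂ fun x => ?_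
      have hW'' : W (star b x) = π (star ⟨b, hb⟩) (W x) := hW (star ⟨b, hb⟩) (star_mem hb) x
      change ⟪x, b (ContinuousLinearMap.adjoint W (W' y))⟫_ℂ =
        ⟪x, ContinuousLinearMap.adjoint W (W' (b y))⟫_ℂ
      rw [inner_star_apply, ContinuousLinearMap.adjoint_inner_right,
        ContinuousLinearMap.adjoint_inner_right, hW' ⟨b, hb⟩ hb, hW'',
        inner_map_star_apply, star_star]
  refine ⟨c, fun x y => ?_⟩
  rw [← ContinuousLinearMap.adjoint_inner_right]
  have := DFunLike.congr_fun hc y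
  rw [ContinuousLinearMap.comp_apply] at this
  rw [this, smul_apply, one_apply_eq_self, inner_smul_right]

theorem IntertwinesOn.inner_eq (hirr : ActsIrreducibly (B : Set (H →L[ℂ] H)))
    (hW : IntertwinesOn B π W) (hW' : IntertwinesOn B π W') {Ω : H} (hΩ : ‖Ω‖ = 1) (x y : H) :
    ⟪W x, W' y⟫_ℂ = ⟪W Ω, W' Ω⟫_ℂ * ⟪x, y⟫_ℂ := by
  obtain ⟨c, hc⟩ := hW.exists_inner_eq hirr hW'
  rw [hc, hc, inner_self_eq_norm_sq_to_K, hΩ]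
  simp

theorem IntertwinesOn.norm_apply (hirr : ActsIrreducibly (B : Set (H →L[ℂ] H)))
    (hW : IntertwinesOn B π W) {Ω : H} (hΩ : ‖Ω‖ = 1) (x : H) : ‖W x‖ = ‖W Ω‖ * ‖x‖ := by
  have h := hW.inner_eq hirr hW hΩ x x
  simp only [inner_self_eq_norm_sq_to_K] at h
  rw [← mul_pow] at h
  have h' : ‖W x‖ ^ 2 = (‖W Ω‖ * ‖x‖) ^ 2 := by exact_mod_cast h
  exact (pow_left_inj₀ (norm_nonneg _) (by positivity) two_ne_zero).1 h'

/-- The vectors corresponding to `Ω` under the intertwiners from the identical representation. -/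
def intertwinerSubspace (π : B →⋆ₙₐ[ℂ] (K →L[ℂ] K)) (Ω : H) : Submodule ℂ K where
  carrier := {y | ∃ W, IntertwinesOn B π W ∧ W Ω = y}
  add_mem' := by
    rintro _ _ ⟨V, hV, rfl⟩ ⟨W, hW, rfl⟩
    exact ⟨V + W, fun b hb x => by simp only [add_apply, hV b hb, hW b hb, map_add], rfl⟩
  zero_mem' := ⟨0, fun b hb x => by simp, rfl⟩
  smul_mem' := by
    rintro c _ ⟨W, hW, rfl⟩
    exact ⟨c • W, fun b hb x => by simp only [smul_apply, hW b hb, map_smul], rfl⟩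

/-- The vectors `W Ω` are exactly those on which `π(1)` acts as the identity and which are dominated
by `Ω` with constant `‖y‖`. These conditions are closed. -/
theorem isClosed_intertwinerSubspace (hirr : ActsIrreducibly (B : Set (H →L[ℂ] H)))
    (h1 : (1 : H →L[ℂ] H) ∈ B) {Ω : H} (hΩ : ‖Ω‖ = 1) :
    IsClosed (intertwinerSubspace π Ω : Set K) := by
  have : (intertwinerSubspace π Ω : Set K) =
      {y | π ⟨1, h1⟩ y = y ∧ ∀ b : B, ‖π b y‖ ≤ ‖y‖ * ‖(b : H →L[ℂ] H) Ω‖} := by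
    ext y
    constructor
    · rintro ⟨W, hW, rfl⟩
      refine ⟨(hW ⟨1, h1⟩ h1 Ω).symm, fun b => ?_⟩
      rw [← hW b b.2, hW.norm_apply hirr hΩ]
    · rintro ⟨hy, hb⟩
      obtain ⟨W, hW, hWΩ⟩ := exists_intertwiner_of_norm_le (NonUnitalStarSubalgebraClass.subtype B)
        π Ω y _ hb ⟨⟨1, h1⟩, rfl, hy⟩
      exact ⟨W, fun b _ => hW b, hWΩ⟩
  rw [this, Set.ofPred_and, Set.ofPred_forall]
  exact (isClosed_eq (by fun_prop) (by fun_prop)).inter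
    (isClosed_iInter fun b => isClosed_le (by fun_prop) (by fun_prop))

/-- The closed span of the ranges of the intertwiners from the identical representation is the range
of an intertwiner from a multiple of it. -/
theorem exists_multiple_intertwiner (hirr : ActsIrreducibly (B : Set (H →L[ℂ] H)))
    (h1 : (1 : H →L[ℂ] H) ∈ B) (π : B →⋆ₙₐ[ℂ] (K →L[ℂ] K)) :
    ∃ (J : Type u) (V : lp (fun _ : J => H) 2 →L[ℂ] K),
      (∀ (b : B) ξ, V (amp H J (b : H →L[ℂ] H) ξ) = π b (V ξ)) ∧
      IsClosed (LinearMap.range V.toLinearMap : Set K) ∧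
      ∀ W, IntertwinesOn B π W → ∀ x, W x ∈ LinearMap.range V.toLinearMap := by
  classical
  have := hirr.1
  obtain ⟨Ω, hΩ⟩ := exists_norm_eq H zero_le_one
  have : CompleteSpace (intertwinerSubspace π Ω) :=
    (isClosed_intertwinerSubspace hirr h1 hΩ).completeSpace_coe
  obtain ⟨s', e, he⟩ := exists_hilbertBasis ℂ (intertwinerSubspace π Ω)
  have hex : ∀ j : s', ∃ W, IntertwinesOn B π W ∧ W Ω = e j := fun j => (e j).2
  choose W hW hWΩ using hex
  have hn : ∀ j, ‖W j Ω‖ = 1 := fun j => by rw [hWΩ]; exact e.orthonormal.1 j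
  let Wi : s' → H →ₗᵢ[ℂ] K := fun j =>
    { toLinearMap := (W j).toLinearMap
      norm_map' := fun x => ((hW j).norm_apply hirr hΩ x).trans (by rw [hn, one_mul]) }
  have hO : OrthogonalFamily ℂ (fun _ : s' => H) Wi := fun i j hij x y => by
    change ⟪W i x, W j y⟫_ℂ = 0
    rw [(hW i).inner_eq hirr (hW j) hΩ, hWΩ, hWΩ]
    have : ⟪(e i : K), e j⟫_ℂ = 0 := e.orthonormal.2 hij
    rw [this, zero_mul]
  set V := hO.linearIsometry.toContinuousLinearMap with hV
  have hVs : ∀ j x, V (lp.single 2 j x) = W j x := fun j x => hO.linearIsometry_apply_single x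
  have hVπ : ∀ (b : B) ξ, V (amp H s' (b : H →L[ℂ] H) ξ) = π b (V ξ) := by
    intro b ξ
    have : V ∘L amp H s' (b : H →L[ℂ] H) = π b ∘L V := eq_of_comp_single fun j x => by
      rw [ContinuousLinearMap.comp_apply, ContinuousLinearMap.comp_apply, amp_single, hVs, hVs,
        hW j b b.2]
    exact DFunLike.congr_fun this ξ
  have hcl : IsClosed (LinearMap.range V.toLinearMap : Set K) :=
    hO.linearIsometry.isometry.isClosedEmbedding.isClosed_range
  refine ⟨s', V, hVπ, hcl, fun W₀ hW₀ x => ?_⟩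
  set R := LinearMap.range V.toLinearMap with hR
  have : CompleteSpace R := hcl.completeSpace_coe
  have hinv : ∀ b, ∀ y ∈ R, π b y ∈ R := by
    rintro b _ ⟨ξ, rfl⟩
    exact ⟨_, hVπ b ξ⟩
  have hcomm : ∀ b y, R.starProjection (π b y) = π b (R.starProjection y) := fun b =>
    starProjection_comm_of_invariant (hinv b) fun y hy => by
      rw [← map_star]; exact hinv _ y hy
  -- The part of `W₀` orthogonal to `R` still intertwines. Its value at `Ω` is orthogonal to the
  -- basis of the intertwiner space, so it is zero, and with it the whole intertwiner.
  have hW₁ : IntertwinesOn B π (W₀ - R.starProjection ∘L W₀) := fun b hb x => by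
    simp only [sub_apply, ContinuousLinearMap.comp_apply, hW₀ b hb, hcomm, map_sub]
  set W₁ := W₀ - R.starProjection ∘L W₀ with hW₁'
  have horth : ∀ x, W₁ x ∈ Rᗮ := fun x => Submodule.sub_starProjection_mem_orthogonal (W₀ x)
  have hΩ0 : (⟨W₁ Ω, W₁, hW₁, rfl⟩ : intertwinerSubspace π Ω) = 0 := by
    refine e.repr.injective ?_
    rw [map_zero]
    ext j
    rw [e.repr_apply_apply, Submodule.coe_inner, ← hWΩ, ← hVs]
    exact horth Ω _ ⟨_, rfl⟩
  have hz : W₁ x = 0 := by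
    rw [← norm_eq_zero, hW₁.norm_apply hirr hΩ, show W₁ Ω = 0 from congrArg Subtype.val hΩ0]
    simp
  rw [hW₁', sub_apply, sub_eq_zero] at hz
  rw [hz]
  exact Submodule.starProjection_apply_mem R _

end Decomposition

/-! ### Ultraweak continuity of matrix coefficients -/

section Ultraweak

variable {H : Type*} [NormedAddCommGroup H] [InnerProductSpace ℂ H] [CompleteSpace H]

/-- A square-summable family vanishing off a countable set can be reindexed by `ℕ`. -/
theorem exists_lp_nat_inner_amp_eq {J : Type*} (ξ η : lp (fun _ : J => H) 2) :
    ∃ ξ' η' : lp (fun _ : ℕ => H) 2, ∀ T : H →L[ℂ] H,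
      ⟪ξ, amp H J T η⟫_ℂ = ⟪ξ', amp H ℕ T η'⟫_ℂ := by
  set s : Set J := {j | η j ≠ 0} with hs
  have hsum : ∀ ζ : lp (fun _ : J => H) 2, Summable fun j => ‖ζ j‖ ^ (2 : ENNReal).toReal :=
    fun ζ => (lp.memℓp ζ).summable (by norm_num)
  have hc : s.Countable := by
    refine (hsum η).countable_support.mono fun j hj => ?_
    rw [Function.mem_support]
    have : 0 < ‖η j‖ := norm_pos_iff.2 hj
    positivity
  have := hc.to_subtype
  obtain ⟨f, hf⟩ := exists_injective_nat s
  have hmem : ∀ ζ : lp (fun _ : J => H) 2,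
      Memℓp (Function.extend f (fun j : s => ζ j) (fun _ => 0)) 2 := fun ζ => by
    refine memℓp_gen ?_
    rw [← hf.summable_iff]
    · refine ((hsum ζ).subtype s).congr fun j => ?_
      simp only [Function.comp_apply, hf.extend_apply]
    · intro n hn
      rw [Function.extend_apply' _ _ _ hn]
      simp
  refine ⟨⟨_, hmem ξ⟩, ⟨_, hmem η⟩, fun T => ?_⟩
  rw [lp.inner_eq_tsum, lp.inner_eq_tsum, ← hf.tsum_eq, ← tsum_subtype_eq_of_support_subset (s := s)]
  · refine tsum_congr fun j => ?_
    simp only [amp_apply, hf.extend_apply]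
  · intro j hj h0
    refine hj ?_
    simp only [amp_apply]
    rw [h0, map_zero, inner_zero_right]
  · intro n hn
    by_contra hn'
    refine hn ?_
    simp only [amp_apply]
    rw [Function.extend_apply' _ _ _ hn', inner_zero_left]

variable {K : Type u} [NormedAddCommGroup K] [InnerProductSpace ℂ K] [CompleteSpace K]
  {B : NonUnitalStarSubalgebra ℂ (H →L[ℂ] H)} {π : B →⋆ₙₐ[ℂ] (K →L[ℂ] K)}

/-- If the ranges of the intertwiners from the identical representation are total in the essential
subspace of `π`, then the matrix coefficients of `π` are ultraweakly continuous. -/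
theorem exists_inner_map_eq (hirr : ActsIrreducibly (B : Set (H →L[ℂ] H)))
    (h1 : (1 : H →L[ℂ] H) ∈ B)
    (htotal : ∀ Q : K →L[ℂ] K, (∀ b y, Q (π b y) = π b (Q y)) →
      (∀ W, IntertwinesOn B π W → ∀ x, Q (W x) = 0) → ∀ y, π ⟨1, h1⟩ y = y → Q y = 0) (x y : K) :
    ∃ ξ η : lp (fun _ : ℕ => H) 2, ∀ b : B,
      ⟪x, π b y⟫_ℂ = ⟪ξ, amp H ℕ (b : H →L[ℂ] H) η⟫_ℂ := by
  obtain ⟨J, V, hV, hcl, hVW⟩ := exists_multiple_intertwiner hirr h1 π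
  set R := LinearMap.range V.toLinearMap with hR
  have : CompleteSpace R := hcl.completeSpace_coe
  have hinv : ∀ b, ∀ y ∈ R, π b y ∈ R := by
    rintro b _ ⟨ξ, rfl⟩
    exact ⟨_, hV b ξ⟩
  have hcomm : ∀ b y, R.starProjection (π b y) = π b (R.starProjection y) := fun b =>
    starProjection_comm_of_invariant (hinv b) fun y hy => by
      rw [← map_star]; exact hinv _ y hy
  -- As `π` may be degenerate, `y` is replaced by its essential part `π(1) y`, which has the same
  -- coefficients.
  have hmul : ∀ b : B, π b (π ⟨1, h1⟩ y) = π b y := fun b => by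
    rw [← mul_apply_eq_comp, ← map_mul]
    exact congrArg (fun c => π c y) (Subtype.ext (mul_one _))
  have h0 := htotal (1 - R.starProjection)
    (fun b y => by simp only [sub_apply, one_apply_eq_self, hcomm, map_sub])
    (fun W hW x => by
      rw [sub_apply, one_apply_eq_self, Submodule.starProjection_eq_self_iff.2 (hVW W hW x),
        sub_self])
    (π ⟨1, h1⟩ y) (hmul _)
  rw [sub_apply, one_apply_eq_self, sub_eq_zero] at h0
  obtain ⟨ζ, hζ⟩ : π ⟨1, h1⟩ y ∈ R := by
    rw [h0]; exact Submodule.starProjection_apply_mem R _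
  obtain ⟨ξ, η, hξη⟩ := exists_lp_nat_inner_amp_eq (ContinuousLinearMap.adjoint V x) ζ
  refine ⟨ξ, η, fun b => ?_⟩
  rw [← hξη, ContinuousLinearMap.adjoint_inner_left, hV, ← hmul b, ← hζ]
  rfl

/-- The left-hand coefficients are the functionals defining the ultraweak topology of `B(K)`, the
right-hand ones are ultraweakly continuous on `B(H)`. -/
theorem isNormalOn_self_of_inner_amp_map_eq
    (h : ∀ x y : lp (fun _ : ℕ => K) 2, ∃ ξ η : lp (fun _ : ℕ => H) 2, ∀ b : B,
      ⟪x, amp K ℕ (π b) y⟫_ℂ = ⟪ξ, amp H ℕ (b : H →L[ℂ] H) η⟫_ℂ) : IsNormalOn π B := by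
  refine continuous_iInf_rng.2 fun x => continuous_iInf_rng.2 fun y => continuous_induced_rng.2 ?_
  obtain ⟨ξ, η, hξη⟩ := h x y
  let τ : TopologicalSpace {b : B // (b : H →L[ℂ] H) ∈ B} := TopologicalSpace.induced
    (fun b => ((b : B) : H →L[ℂ] H)) (ultraweakTopology H)
  refine @Continuous.congr _ _ τ _ _ _ (@Continuous.comp _ _ _ τ (ultraweakTopology H) _ _ _
    (continuous_inner_amp ξ η) continuous_induced_dom) fun b => ?_
  rw [Function.comp_apply, ← hξη, lp.inner_eq_tsum]
  rfl

end Ultraweak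

theorem theoremA6 {G : Type*} [Group G] [TopologicalSpace G] [IsTopologicalGroup G]
    [CompactSpace G] [T2Space G]
    {H : Type*} [NormedAddCommGroup H] [InnerProductSpace ℂ H] [CompleteSpace H]
    (B : NonUnitalStarSubalgebra ℂ (H →L[ℂ] H)) (hB : IsClosed (B : Set (H →L[ℂ] H)))
    (hirr : ActsIrreducibly (B : Set (H →L[ℂ] H)))
    (U : G →* unitary (H →L[ℂ] H)) (hU : IsContinuousUnitaryRep U)
    (hα : InducesAction U B) (hfull : HasFullHilbertSpectrum U B)
    {K : Type*} [NormedAddCommGroup K] [InnerProductSpace ℂ K] [CompleteSpace K]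
    (π : B →⋆ₙₐ[ℂ] (K →L[ℂ] K)) (hπ : IsNormalOn π (fixedPointAlgebra U B)) :
    IsNormalOn π B := by
  let _ : MeasurableSpace G := borel G
  have : BorelSpace G := ⟨rfl⟩
  let μ : Measure G := Measure.haarMeasure ⊤
  have : IsProbabilityMeasure μ := ⟨Measure.haarMeasure_self⟩
  have hle : fixedPointAlgebra U B ≤ B := fun b hb => hb.1
  have h1 : (1 : H →L[ℂ] H) ∈ fixedPointAlgebra U B :=
    ⟨hfull.one_mem, fun g => by simp [conjBy]⟩
  -- The decomposition is applied to the countable multiple of `π`, so that `z` is a square-summable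
  -- sequence in `K` and `a ↦ ⟪z, π(a) z⟫` is a functional to which normality on `B^G` applies.
  refine isNormalOn_self_of_inner_amp_map_eq fun x y =>
    exists_inner_map_eq (π := (amp K ℕ).comp π) hirr (hle h1) (fun Q hQ hW z hz => ?_) x y
  obtain ⟨φ, hφ, hφz⟩ := hπ.exists_mem_span_ultraweakFunctional hle z z
  exact map_eq_zero_of_mem_span_ultraweakFunctional hle h1 hz hφ hφz fun S hS =>
    comp_eq_zero_of_intertwinesOn hB hirr hU hα hfull μ hQ hW hS

end
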